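/- **Setting.** Consider a finite polygonal mesh of a closed oriented surface without boundary (for instance a sphere), with vertices $j$, edges $e$ and cells $i$; the two end points of an edge are different vertices and its two sides are different cells. The surface is approximated by plane triangles in $\mathbb{R}^3$: each vertex gets a position, each cell a dual vertex, each edge a point on it (where it meets the dual edge), and each cell with $n$ edges is cut into $2n$ non-degenerate plane triangles with corners (dual vertex of the cell, edge point, end point of that edge). Let $\mathbf{k}$ be the unit normal of a triangle given by the orientation, $\mathbf{u}^\perp=\mathbf{k}\times\mathbf{u}$, let $\nabla$, $\nabla\cdot$ be the surface gradient and divergence, and let $\langle\cdot,\cdot\rangle$ be the $L^2$ inner product over the surface. Each edge $e$ has a unit tangent $\mathbf{t}$ and a unit normal $\mathbf{n}$ with $\mathbf{t}=\mathbf{k}\times\mathbf{n}$. Let $(D_1)_{ej}=t_{ej}$, which is $1$ if $\mathbf{t}$ points along $e$ towards $j$, $-1$ if it points away from $j$, and $0$ if $e$ is not incident on $j$; let $(D_2)_{ie}=n_{ei}$, which is $1$ if $\mathbf{n}$ points out of cell $i$, $-1$ if it points into cell $i$, and $0$ otherwise; and let $\overline{D}_2=D_1^T$. **Compound basis functions**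 (P1, RT0 and P0 denote the continuous piecewise linear, lowest order Raviart–Thomas and piecewise constant spaces on the triangles; an *interior* P1 function is one that vanishes on all cell boundaries). * $\alpha_i$ is constant on cell $i$ with $\int_{\text{cell } i}\alpha_i\,dA=1$, and is zero on all other cells. * $\gamma_j$ is the P1 function with $\gamma_j=\delta_{jj'}$ at each vertex $j'$, with constant gradient along each edge, and with $\langle\nabla\gamma_j,\nabla\eta\rangle=0$ for every interior P1 function $\eta$. * $\mathbf{v}_e$ is the RT0 field whose normal component is constant along each edge, with $\int_{\text{edge } e'}\mathbf{v}_e\cdot\mathbf{n}\,dl=\delta_{ee'}$, with $\nabla\cdot\mathbf{v}_e$ constant on each cell, and with $\langle\mathbf{v}_e,\nabla^\perp\eta\rangle=0$ for every interior P1 function $\eta$, where $\nabla^\perp\eta=\mathbf{k}\times\nabla\eta$. **Claim.** Such functions $\gamma_j$ and $\mathbf{v}_e$ exist for all $j$ and $e$. Let $W_{ee'}=-\langle\mathbf{v}_e,\mathbf{v}_{e'}^\perp\rangle$ and $R_{ji}=\langle\gamma_j,\alpha_i\rangle$. Then $W$ is antisymmetric, $$-\overline{D}_2\,W=R\,D_2,$$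 and consequently $\overline{D}_2\,W\,D_1=0$. -/

import Mathlib

open scoped BigOperators

noncomputable section

/-- Euclidean three-space. -/
abbrev Space := EuclideanSpace ℝ (Fin 3)

/-- The cross product on Euclidean three-space. -/
def cross (u v : Space) : Space :=
  WithLp.toLp 2 (crossProduct (WithLp.ofLp u) (WithLp.ofLp v))

/-- A finite polygonal mesh of a closed oriented surface, the surface being approximated by plane
triangular facets.

The combinatorics is a rotation system on the finite type `D` of directed edges ("darts"):
`rev` reverses a dart, and `next` moves to the following dart when the boundary of the cell on the
left of the dart is traversed counterclockwise. The cells are the cycles of `next`, the vertices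
are the cycles of the rotation `next ∘ rev` of the darts leaving a vertex, and the edges are the
pairs `{d, rev d}`. There is no boundary.

The geometry is given by the positions of the primal vertices (`xV`), of one point on each primal
edge, where it meets the dual edge (`xE`), and of the dual vertices, one in each cell (`xC`).
Every cell with `n` edges is thereby cut into `2 n` plane triangles. -/
structure PolygonalMesh (D V E C : Type*) where
  rev : Equiv.Perm D
  next : Equiv.Perm D
  /-- the vertex at which a dart starts -/
  orig : D → V
  /-- the undirected edge of a dart -/
  edge : D → E
  /-- the cell on the left of a dart -/
  cell : D → C
  /-- the dart along which the unit tangent of an edge points -/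
  pos : E → D
  rev_rev : ∀ d, rev (rev d) = d
  rev_ne : ∀ d, rev d ≠ d
  edge_eq_iff : ∀ d d', edge d = edge d' ↔ d' = d ∨ d' = rev d
  edge_pos : ∀ e, edge (pos e) = e
  cell_surjective : Function.Surjective cell
  cell_eq_iff : ∀ d d', cell d = cell d' ↔ next.SameCycle d d'
  orig_surjective : Function.Surjective orig
  orig_eq_iff : ∀ d d', orig d = orig d' ↔ (next * rev).SameCycle d d'
  /-- the two end points of an edge are different vertices -/
  orig_rev_ne : ∀ d, orig (rev d) ≠ orig d
  /-- the two sides of an edge are different cells -/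
  cell_rev_ne : ∀ d, cell (rev d) ≠ cell d
  xV : V → Space
  xE : E → Space
  xC : C → Space
  /-- the triangle with corners dual vertex, start of `d`, edge point of `d` is nondegenerate -/
  nondegenerate₁ : ∀ d, cross (xV (orig d) - xC (cell d)) (xE (edge d) - xC (cell d)) ≠ 0
  /-- the triangle with corners dual vertex, edge point of `d`, end of `d` is nondegenerate -/
  nondegenerate₂ : ∀ d,
    cross (xE (edge d) - xC (cell d)) (xV (orig (rev d)) - xC (cell d)) ≠ 0

namespace PolygonalMesh

variable {D V E C : Type*}

/-! ### The supermesh of triangular subelements -/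

/-- The position of a node of the supermesh: a primal vertex, an edge point or a dual vertex. -/
def point (M : PolygonalMesh D V E C) : V ⊕ (E ⊕ C) → Space :=
  Sum.elim M.xV (Sum.elim M.xE M.xC)

/-- The nodes of the triangular subelements, in counterclockwise order. The subelements are indexed
by `D × Bool`; `(d, false)` lies between the dual vertex of the cell of `d` and the first half of
`d`, and `(d, true)` between that dual vertex and the second half of `d`. -/
def node (M : PolygonalMesh D V E C) : D × Bool → Fin 3 → V ⊕ (E ⊕ C)
  | (d, false) =>
      ![Sum.inr (Sum.inr (M.cell d)), Sum.inl (M.orig d), Sum.inr (Sum.inl (M.edge d))]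
  | (d, true) =>
      ![Sum.inr (Sum.inr (M.cell d)), Sum.inr (Sum.inl (M.edge d)), Sum.inl (M.orig (M.rev d))]

/-- The corners of a subelement. -/
def corner (M : PolygonalMesh D V E C) (T : D × Bool) (a : Fin 3) : Space :=
  M.point (M.node T a)

/-- `(p₁ - p₀) × (p₂ - p₀)` for the corners `p₀, p₁, p₂` of a subelement. -/
def areaVector (M : PolygonalMesh D V E C) (T : D × Bool) : Space :=
  cross (M.corner T 1 - M.corner T 0) (M.corner T 2 - M.corner T 0)

/-- The area of a subelement. -/
def area (M : PolygonalMesh D V E C) (T : D × Bool) : ℝ := ‖M.areaVector T‖ / 2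

/-- The unit vertical vector `k` on a subelement: the unit normal for which the corners run
counterclockwise. -/
def vert (M : PolygonalMesh D V E C) (T : D × Bool) : Space :=
  ‖M.areaVector T‖⁻¹ • M.areaVector T

/-- The vector along side `a` of a subelement, the side opposite to corner `a`, in the
counterclockwise direction. -/
def sideVector (M : PolygonalMesh D V E C) (T : D × Bool) (a : Fin 3) : Space :=
  M.corner T (a + 2) - M.corner T (a + 1)

/-- Side `a` of a subelement. -/
def side (M : PolygonalMesh D V E C) (T : D × Bool) (a : Fin 3) : Set Space :=
  segment ℝ (M.corner T (a + 1)) (M.corner T (a + 2))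

/-- The unit vector in the plane of a subelement that is normal to side `a` and points out of the
subelement. -/
def outNormal (M : PolygonalMesh D V E C) (T : D × Bool) (a : Fin 3) : Space :=
  ‖M.sideVector T a‖⁻¹ • cross (M.sideVector T a) (M.vert T)

/-- The side (of the adjacent subelement) to which a side of a subelement is glued. Sides `0` are
the halves of the primal edges. -/
def glue (M : PolygonalMesh D V E C) : D × Bool → Fin 3 → (D × Bool) × Fin 3
  | (d, false), 0 => ((M.rev d, true), 0)
  | (d, true), 0 => ((M.rev d, false), 0)
  | (d, false), 1 => ((d, true), 2)
  | (d, true), 2 => ((d, false), 1)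
  | (d, true), 1 => ((M.next d, false), 2)
  | (d, false), 2 => ((M.next.symm d, true), 1)

/-! ### Fields and integrals

A field is given on each subelement separately, so that it may jump between subelements. On a
subelement it is written as a function on the ambient space, of which only the restriction to the
subelement matters. -/

/-- The integral over a subelement with respect to area, in the parametrization
`p₀ + s (p₁ - p₀) + t (p₂ - p₀)`, `0 ≤ s ≤ 1`, `0 ≤ t ≤ 1 - s`. -/
def triIntegral (M : PolygonalMesh D V E C) (T : D × Bool) (f : Space → ℝ) : ℝ :=
  ‖M.areaVector T‖ * ∫ s in (0 : ℝ)..1, ∫ t in (0 : ℝ)..(1 - s),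
    f (M.corner T 0 + s • (M.corner T 1 - M.corner T 0) + t • (M.corner T 2 - M.corner T 0))

/-- The integral over the whole surface of a scalar field. -/
def integral [Fintype D] (M : PolygonalMesh D V E C) (f : D × Bool → Space → ℝ) : ℝ :=
  ∑ T : D × Bool, M.triIntegral T (f T)

/-- The inner product of scalar fields. -/
def innerScalar [Fintype D] (M : PolygonalMesh D V E C) (f g : D × Bool → Space → ℝ) : ℝ :=
  M.integral fun T x => f T x * g T x

/-- The inner product of vector fields. -/
def innerVector [Fintype D] (M : PolygonalMesh D V E C) (u v : D × Bool → Space → Space) : ℝ :=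
  M.integral fun T x => inner ℝ (u T x) (v T x)

/-- `u^⊥ = k × u`. -/
def perp (M : PolygonalMesh D V E C) (u : D × Bool → Space → Space) : D × Bool → Space → Space :=
  fun T x => cross (M.vert T) (u T x)

/-- The surface gradient: the tangential part of the gradient. -/
def grad (M : PolygonalMesh D V E C) (f : D × Bool → Space → ℝ) : D × Bool → Space → Space :=
  fun T x => gradient (f T) x - inner ℝ (gradient (f T) x) (M.vert T) • M.vert T

/-- The surface divergence: the trace of the derivative over the directions tangential to the
subelement. -/
def div (M : PolygonalMesh D V E C) (u : D × Bool → Space → Space) : D × Bool → Space → ℝ :=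
  fun T x => LinearMap.trace ℝ Space (fderiv ℝ (u T) x : Space →ₗ[ℝ] Space)
    - inner ℝ (fderiv ℝ (u T) x (M.vert T)) (M.vert T)

/-- The integral of the outward normal component of a vector field along a side of a subelement. -/
def sideFlux (M : PolygonalMesh D V E C) (u : D × Bool → Space → Space) (T : D × Bool)
    (a : Fin 3) : ℝ :=
  ‖M.sideVector T a‖ * ∫ t in (0 : ℝ)..1,
    inner ℝ (u T (M.corner T (a + 1) + t • M.sideVector T a)) (M.outNormal T a)

/-- `∫_{edge e} u ⋅ n dl`. The unit normal `n` of an edge points out of the cell on the left of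
the edge, so that the unit tangent is `t = k × n`. -/
def edgeFlux (M : PolygonalMesh D V E C) (u : D × Bool → Space → Space) (e : E) : ℝ :=
  ∑ s : Bool, M.sideFlux u (M.pos e, s) 0

/-! ### The finite element spaces on the subelements -/

/-- `f` is a continuous piecewise linear (P1) field on the supermesh, with the given values at the
nodes. (A piecewise linear field is continuous across all sides if and only if it has a single
value at each node.) -/
def IsP1 (M : PolygonalMesh D V E C) (f : D × Bool → Space → ℝ) (val : V ⊕ (E ⊕ C) → ℝ) : Prop :=
  (∀ T, ∃ (g : Space) (c : ℝ), ∀ x, f T x = inner ℝ g x + c) ∧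
  ∀ T a, f T (M.corner T a) = val (M.node T a)

/-- `f` is a continuous piecewise linear field that vanishes on the boundaries of all cells. -/
def IsInteriorP1 (M : PolygonalMesh D V E C) (f : D × Bool → Space → ℝ) : Prop :=
  ∃ val : V ⊕ (E ⊕ C) → ℝ, M.IsP1 f val ∧
    (∀ j, val (Sum.inl j) = 0) ∧ ∀ e, val (Sum.inr (Sum.inl e)) = 0

/-- `u` is a lowest order Raviart-Thomas (RT0) field on the supermesh: on each subelement a
tangential field `a + b (x - p₀)`, with normal components that match on the common side of any two
adjacent subelements. -/
def IsRT0 (M : PolygonalMesh D V E C) (u : D × Bool → Space → Space) : Prop :=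
  (∀ T, ∃ (a : Space) (b : ℝ), inner ℝ a (M.vert T) = 0 ∧
    ∀ x, u T x = a + b • (x - M.corner T 0)) ∧
  ∀ T a, ∀ x ∈ M.side T a,
    inner ℝ (u T x) (M.outNormal T a) +
      inner ℝ (u (M.glue T a).1 x) (M.outNormal (M.glue T a).1 (M.glue T a).2) = 0

/-! ### The compound basis functions -/

/-- The area of a primal cell. -/
def cellArea [Fintype D] [DecidableEq C] (M : PolygonalMesh D V E C) (i : C) : ℝ :=
  ∑ T : D × Bool, if M.cell T.1 = i then M.area T else 0

/-- The basis function `α_i` of `V₂`: constant on cell `i` with integral `1`, zero elsewhere. -/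
def alpha [Fintype D] [DecidableEq C] (M : PolygonalMesh D V E C) (i : C) :
    D × Bool → Space → ℝ :=
  fun T _ => if M.cell T.1 = i then (M.cellArea i)⁻¹ else 0

/-- `f` is the basis function `γ_j` of `V₀`: continuous and piecewise linear on the subelements,
`1` at vertex `j` and `0` at all other vertices, with constant gradient along each primal edge,
and extended into the cells by discrete harmonic extension (`∇² f = 0` in the interior of each
cell, tested with the P1 functions that vanish on the cell boundaries). -/
def IsGamma [Fintype D] [DecidableEq V] (M : PolygonalMesh D V E C) (j : V)
    (f : D × Bool → Space → ℝ) : Prop :=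
  ∃ val : V ⊕ (E ⊕ C) → ℝ, M.IsP1 f val ∧
    (∀ j', val (Sum.inl j') = if j' = j then 1 else 0) ∧
    (∀ d, ∃ slope : ℝ,
      val (Sum.inr (Sum.inl (M.edge d))) - val (Sum.inl (M.orig d))
        = slope * dist (M.xV (M.orig d)) (M.xE (M.edge d)) ∧
      val (Sum.inl (M.orig (M.rev d))) - val (Sum.inr (Sum.inl (M.edge d)))
        = slope * dist (M.xE (M.edge d)) (M.xV (M.orig (M.rev d)))) ∧
    ∀ g, M.IsInteriorP1 g → M.innerVector (M.grad f) (M.grad g) = 0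

/-- `u` is the basis function `v_e` of `V₁`: an RT0 field on the subelements whose normal component
is constant along each primal edge, with flux `1` through edge `e` and `0` through all other
edges, extended into the cells by discrete harmonic extension (`∇ (∇ ⋅ u) = 0`: the divergence is
constant on each cell; `k ⋅ ∇ × u = 0` in the interior of each cell, tested with the P1 functions
that vanish on the cell boundaries). -/
def IsVelocityBasis [Fintype D] [DecidableEq E] (M : PolygonalMesh D V E C) (e : E)
    (u : D × Bool → Space → Space) : Prop :=
  M.IsRT0 u ∧
  (∀ e', ∃ c : ℝ, ∀ s : Bool, ∀ x ∈ M.side (M.pos e', s) 0,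
    inner ℝ (u (M.pos e', s) x) (M.outNormal (M.pos e', s) 0) = c) ∧
  (∀ e', M.edgeFlux u e' = if e' = e then 1 else 0) ∧
  (∃ δ : C → ℝ, ∀ T x, M.div u T x = δ (M.cell T.1)) ∧
  ∀ g, M.IsInteriorP1 g → M.innerVector u (M.perp (M.grad g)) = 0

/-! ### The matrices -/

/-- `(D₁)_{e j} = t_{e j}`: `1` if the tangent of edge `e` points towards vertex `j`, `-1` if it
points away from `j`, and `0` if `e` is not incident on `j`. -/
def D₁ [DecidableEq V] (M : PolygonalMesh D V E C) : Matrix E V ℝ :=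
  Matrix.of fun e j =>
    if M.orig (M.rev (M.pos e)) = j then 1 else if M.orig (M.pos e) = j then -1 else 0

/-- `(D₂)_{i e} = n_{e i}`: `1` if the normal of edge `e` points out of cell `i`, `-1` if it points
into `i`, and `0` if `e` is not an edge of `i`. -/
def D₂ [DecidableEq C] (M : PolygonalMesh D V E C) : Matrix C E ℝ :=
  Matrix.of fun i e =>
    if M.cell (M.pos e) = i then 1 else if M.cell (M.rev (M.pos e)) = i then -1 else 0

/-- The discrete curl `D̄₂ = D₁ᵀ`. -/
def D₂bar [DecidableEq V] (M : PolygonalMesh D V E C) : Matrix V E ℝ := M.D₁.transpose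

/-- The Coriolis matrix `W_{e e'} = - ⟨v_e, v_{e'}^⊥⟩`. -/
def W [Fintype D] (M : PolygonalMesh D V E C) (v : E → D × Bool → Space → Space) :
    Matrix E E ℝ :=
  Matrix.of fun e e' => -M.innerVector (v e) (M.perp (v e'))

/-- The averaging matrix `R_{j i} = ⟨γ_j, α_i⟩`. -/
def R [Fintype D] [DecidableEq C] (M : PolygonalMesh D V E C)
    (γ : V → D × Bool → Space → ℝ) : Matrix V C ℝ :=
  Matrix.of fun j i => M.innerScalar (γ j) (M.alpha i)

end PolygonalMesh

end

noncomputable section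

/-! ### Vector algebra in three-space -/

/-! On a triangle an RT0 field is the same thing as its three outward side fluxes (`rtField`,
`IsRT0.exists_eq_rtField`), and the rotated gradient of a P1 field is the RT0 field whose fluxes are
differences of nodal values (`IsP1.perp_grad`). So `∇^⊥ γ_j` and the `v_e` live in one space,
described by `IsHarmonicFlux`: constant normal component on primal edges, constant divergence on
cells, orthogonality to rotated gradients of interior P1 fields.

A field in this space is determined by its primal edge fluxes (`IsHarmonicFlux.rtField_eq_zero`): if
these vanish, so does the divergence, hence the field is the rotated gradient of an interior P1
field and is orthogonal to itself. Comparing edge fluxes gives `∇^⊥ γ_j = -∑ t_{ej} v_e`. Pairing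
with `v_{e'}^⊥`, the left side becomes `⟨∇ γ_j, v_{e'}⟩ = -⟨γ_j, ∇ ⋅ v_{e'}⟩` by integration by
parts (`IsP1.innerVector_grad`), and `∇ ⋅ v_{e'} = ∑ n_{e'i} α_i` (`innerScalar_div_rtField`). This
is the matrix identity; the last claim follows from it and `D₂ D₁ = 0`.

For existence, fluxes with the right edge values and divergence are found by solving a difference
equation around each cell (`exists_flux`). The orthogonality is then reached by adjusting one dual
vertex value per cell (`exists_interior_correction`), which leaves edge fluxes and divergence alone.
-/

theorem Space.inner_eq (u v : Space) : inner ℝ u v = u 0 * v 0 + u 1 * v 1 + u 2 * v 2 := by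
  simp [PiLp.inner_apply, Fin.sum_univ_three, mul_comm]

@[simp] theorem cross_zero_coord (u v : Space) : cross u v 0 = u 1 * v 2 - u 2 * v 1 := by
  simp [cross, cross_apply]

@[simp] theorem cross_one_coord (u v : Space) : cross u v 1 = u 2 * v 0 - u 0 * v 2 := by
  simp [cross, cross_apply]

@[simp] theorem cross_two_coord (u v : Space) : cross u v 2 = u 0 * v 1 - u 1 * v 0 := by
  simp [cross, cross_apply]

theorem Space.ext_coord {u v : Space} (h0 : u 0 = v 0) (h1 : u 1 = v 1) (h2 : u 2 = v 2) :
    u = v := by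
  ext i
  fin_cases i
  · exact h0
  · exact h1
  · exact h2

theorem inner_cross_comm (k u w : Space) : inner ℝ u (cross k w) = -inner ℝ w (cross k u) := by
  simp only [Space.inner_eq, cross_zero_coord, cross_one_coord, cross_two_coord]
  ring

theorem inner_cross_cyclic (u v w : Space) : inner ℝ u (cross v w) = inner ℝ (cross u v) w := by
  simp only [Space.inner_eq, cross_zero_coord, cross_one_coord, cross_two_coord]
  ring

theorem inner_cross_self_left (u v : Space) : inner ℝ u (cross u v) = 0 := by
  simp only [Space.inner_eq, cross_zero_coord, cross_one_coord, cross_two_coord]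
  ring

theorem inner_cross_self_right (u v : Space) : inner ℝ u (cross v u) = 0 := by
  simp only [Space.inner_eq, cross_zero_coord, cross_one_coord, cross_two_coord]
  ring

theorem cross_smul_right (c : ℝ) (u v : Space) : cross u (c • v) = c • cross u v := by
  apply Space.ext_coord <;> simp <;> ring

theorem cross_zero_right (u : Space) : cross u 0 = 0 := by
  apply Space.ext_coord <;> simp

theorem inner_cross_cross (k u w : Space) :
    inner ℝ (cross k u) (cross k w) = inner ℝ k k * inner ℝ u w - inner ℝ k u * inner ℝ k w := by
  simp only [Space.inner_eq, cross_zero_coord, cross_one_coord, cross_two_coord]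
  ring

theorem continuous_cross (k : Space) : Continuous (cross k) := by
  have h : Continuous fun u : Space =>
      (WithLp.toLp 2 (crossProduct (WithLp.ofLp k) (WithLp.ofLp u)) : Space) :=
    (PiLp.continuous_toLp 2 _).comp
      ((LinearMap.continuous_of_finiteDimensional _).comp (PiLp.continuous_ofLp 2 _))
  exact h

/-- A vector orthogonal to a nonzero `N = s × s'` and to `s × N` and `s' × N` vanishes. -/
theorem eq_zero_of_inner_cross_eq_zero {s s' w : Space} (hN : cross s s' ≠ 0)
    (h0 : inner ℝ w (cross s s') = 0) (h1 : inner ℝ w (cross s (cross s s')) = 0)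
    (h2 : inner ℝ w (cross s' (cross s s')) = 0) : w = 0 := by
  set N := cross s s' with hNdef
  -- Cramer's rule for `N`, `s × N`, `s' × N`, whose triple product is `⟨N, N⟩²`.
  have key : (inner ℝ N N * inner ℝ N N) • w =
      inner ℝ w N • cross (cross s N) (cross s' N) + inner ℝ w (cross s N) • cross (cross s' N) N
        + inner ℝ w (cross s' N) • cross N (cross s N) := by
    rw [hNdef]
    apply Space.ext_coord <;>
    · simp only [Space.inner_eq, cross_zero_coord, cross_one_coord, cross_two_coord,
        PiLp.add_apply, PiLp.smul_apply, smul_eq_mul]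
      ring
  rw [h0, h1, h2, zero_smul, zero_smul, zero_smul, add_zero, add_zero] at key
  have hne : inner ℝ N N ≠ 0 := inner_self_ne_zero.mpr hN
  exact (smul_eq_zero.mp key).resolve_left (mul_ne_zero hne hne)

namespace PolygonalMesh

variable {D V E C : Type*}

/-! ### Geometry of a subelement -/

theorem areaVector_ne_zero (M : PolygonalMesh D V E C) (T : D × Bool) : M.areaVector T ≠ 0 := by
  obtain ⟨d, s⟩ := T
  cases s
  · exact M.nondegenerate₁ d
  · exact M.nondegenerate₂ d

theorem norm_areaVector_pos (M : PolygonalMesh D V E C) (T : D × Bool) :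
    0 < ‖M.areaVector T‖ := norm_pos_iff.mpr (M.areaVector_ne_zero T)

theorem area_pos (M : PolygonalMesh D V E C) (T : D × Bool) : 0 < M.area T :=
  half_pos (M.norm_areaVector_pos T)

theorem inner_vert_vert (M : PolygonalMesh D V E C) (T : D × Bool) :
    inner ℝ (M.vert T) (M.vert T) = 1 := by
  have h := (M.norm_areaVector_pos T).ne'
  rw [vert, real_inner_smul_left, real_inner_smul_right, real_inner_self_eq_norm_sq]
  field_simp

theorem inner_areaVector_vert (M : PolygonalMesh D V E C) (T : D × Bool) :
    inner ℝ (M.areaVector T) (M.vert T) = ‖M.areaVector T‖ := by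
  have h := (M.norm_areaVector_pos T).ne'
  rw [vert, real_inner_smul_right, real_inner_self_eq_norm_sq]
  field_simp

theorem fin_three_cases {p : Fin 3 → Prop} (h0 : p 0) (h1 : p 1) (h2 : p 2) (a : Fin 3) : p a := by
  fin_cases a
  · exact h0
  · exact h1
  · exact h2

theorem cross_sideVector (M : PolygonalMesh D V E C) (T : D × Bool) (a : Fin 3) :
    cross (M.corner T (a + 1) - M.corner T a) (M.sideVector T a) = M.areaVector T := by
  revert a
  apply fin_three_cases <;> simp only [sideVector, areaVector, Fin.reduceAdd, zero_add] <;>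
  · apply Space.ext_coord <;> simp <;> ring

theorem sideVector_ne_zero (M : PolygonalMesh D V E C) (T : D × Bool) (a : Fin 3) :
    M.sideVector T a ≠ 0 := by
  intro h
  have := M.cross_sideVector T a
  rw [h, cross_zero_right] at this
  exact M.areaVector_ne_zero T this.symm

theorem norm_sideVector_pos (M : PolygonalMesh D V E C) (T : D × Bool) (a : Fin 3) :
    0 < ‖M.sideVector T a‖ := norm_pos_iff.mpr (M.sideVector_ne_zero T a)

/-- The outward normal of side `a`, with the length of the side. -/
def sideNormal (M : PolygonalMesh D V E C) (T : D × Bool) (a : Fin 3) : Space :=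
  cross (M.sideVector T a) (M.vert T)

theorem outNormal_eq (M : PolygonalMesh D V E C) (T : D × Bool) (a : Fin 3) :
    M.outNormal T a = ‖M.sideVector T a‖⁻¹ • M.sideNormal T a := rfl

theorem inner_outNormal (M : PolygonalMesh D V E C) (T : D × Bool) (a : Fin 3) (w : Space) :
    inner ℝ w (M.outNormal T a) = ‖M.sideVector T a‖⁻¹ * inner ℝ w (M.sideNormal T a) := by
  rw [outNormal_eq, real_inner_smul_right]

theorem inner_sideVector_sideNormal (M : PolygonalMesh D V E C) (T : D × Bool) (a : Fin 3) :
    inner ℝ (M.sideVector T a) (M.sideNormal T a) = 0 := inner_cross_self_left _ _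

/-- Side length times height is twice the area, and the corners other than `a` lie on side `a`. This
duality underlies both the RT0 fields and the barycentric coordinates below. -/
theorem inner_sub_corner_sideNormal (M : PolygonalMesh D V E C) (T : D × Bool) (a b : Fin 3) :
    inner ℝ (M.corner T (a + 1) - M.corner T b) (M.sideNormal T a) =
      if b = a then ‖M.areaVector T‖ else 0 := by
  have hb : b = a ∨ b = a + 1 ∨ b = a + 2 := by
    revert a b; decide
  rcases hb with rfl | rfl | rfl
  · rw [if_pos rfl, sideNormal, inner_cross_cyclic, cross_sideVector, inner_areaVector_vert]
  · rw [if_neg (by revert a; decide), sub_self, inner_zero_left]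
  · rw [if_neg (by revert a; decide), ← neg_sub, inner_neg_left]
    exact neg_eq_zero.mpr (M.inner_sideVector_sideNormal T a)

theorem inner_sideVector_vert (M : PolygonalMesh D V E C) (T : D × Bool) (a : Fin 3) :
    inner ℝ (M.sideVector T a) (M.vert T) = 0 := by
  rw [vert, real_inner_smul_right, ← M.cross_sideVector T a, inner_cross_self_right, mul_zero]

theorem inner_corner_sub_corner_vert (M : PolygonalMesh D V E C) (T : D × Bool) (a b : Fin 3) :
    inner ℝ (M.corner T a - M.corner T b) (M.vert T) = 0 := by
  have hb : a = b ∨ a = b + 2 ∨ b = a + 2 := by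
    revert a b; decide
  have h : ∀ c : Fin 3, inner ℝ (M.corner T (c + 2) - M.corner T c) (M.vert T) = 0 := by
    intro c
    have h := M.inner_sideVector_vert T (c + 1)
    rw [sideVector, add_assoc, add_assoc, show (1 + 2 : Fin 3) = 0 from rfl,
      show (1 + 1 : Fin 3) = 2 from rfl, add_zero, ← neg_sub, inner_neg_left, neg_eq_zero] at h
    exact h
  rcases hb with rfl | rfl | rfl
  · simp
  · exact h b
  · rw [← neg_sub, inner_neg_left, h, neg_zero]

theorem inner_areaVector_right (M : PolygonalMesh D V E C) (T : D × Bool) (w : Space) :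
    inner ℝ w (M.areaVector T) = ‖M.areaVector T‖ * inner ℝ w (M.vert T) := by
  have h := (M.norm_areaVector_pos T).ne'
  rw [vert, real_inner_smul_right]
  field_simp

theorem inner_cross_areaVector (M : PolygonalMesh D V E C) (T : D × Bool) (a : Fin 3) (w : Space) :
    inner ℝ w (cross (M.sideVector T a) (M.areaVector T)) =
      ‖M.areaVector T‖ * inner ℝ w (M.sideNormal T a) := by
  have h := (M.norm_areaVector_pos T).ne'
  rw [sideNormal, vert, cross_smul_right, real_inner_smul_right]
  field_simp

/-- A tangential vector is determined by its normal components on two sides. -/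
theorem eq_zero_of_inner_sideNormal_eq_zero (M : PolygonalMesh D V E C) {T : D × Bool} {w : Space}
    (h0 : inner ℝ w (M.vert T) = 0) (h1 : inner ℝ w (M.sideNormal T 1) = 0)
    (h2 : inner ℝ w (M.sideNormal T 2) = 0) : w = 0 := by
  have hc : cross (M.sideVector T 1) (M.sideVector T 2) = M.areaVector T := by
    simp only [sideVector, areaVector, Fin.reduceAdd]
    apply Space.ext_coord <;> simp <;> ring
  apply eq_zero_of_inner_cross_eq_zero (s := M.sideVector T 1) (s' := M.sideVector T 2) <;>
    rw [hc]
  · exact M.areaVector_ne_zero T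
  · rw [inner_areaVector_right, h0, mul_zero]
  · rw [inner_cross_areaVector, h1, mul_zero]
  · rw [inner_cross_areaVector, h2, mul_zero]

/-! ### Integrals over subelements -/

theorem triIntegral_add (M : PolygonalMesh D V E C) (T : D × Bool) {f g : Space → ℝ}
    (hf : Continuous f) (hg : Continuous g) :
    M.triIntegral T (fun x => f x + g x) = M.triIntegral T f + M.triIntegral T g := by
  have hi : ∀ h : Space → ℝ, Continuous h → Continuous fun s : ℝ => ∫ t in (0 : ℝ)..(1 - s),
      h (M.corner T 0 + s • (M.corner T 1 - M.corner T 0) +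
        t • (M.corner T 2 - M.corner T 0)) := by
    intro h hh
    apply intervalIntegral.continuous_parametric_intervalIntegral_of_continuous
    · fun_prop
    · fun_prop
  rw [triIntegral, triIntegral, triIntegral, ← mul_add,
    ← intervalIntegral.integral_add ((hi f hf).intervalIntegrable _ _)
      ((hi g hg).intervalIntegrable _ _)]
  congr 2
  ext s
  apply intervalIntegral.integral_add
  · exact Continuous.intervalIntegrable (by fun_prop) _ _
  · exact Continuous.intervalIntegrable (by fun_prop) _ _

theorem triIntegral_const_mul (M : PolygonalMesh D V E C) (T : D × Bool) (c : ℝ) (f : Space → ℝ) :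
    M.triIntegral T (fun x => c * f x) = c * M.triIntegral T f := by
  simp only [triIntegral, intervalIntegral.integral_const_mul]
  ring

/-- The mean of an affine function over a triangle is the mean of its corner values. All explicit
integrals below reduce to this. -/
theorem triIntegral_affine (M : PolygonalMesh D V E C) (T : D × Bool) (g : Space) (c : ℝ) :
    M.triIntegral T (fun x => inner ℝ g x + c) =
      M.area T / 3 * ∑ a, (inner ℝ g (M.corner T a) + c) := by
  have h : ∀ s : ℝ, (∫ t in (0 : ℝ)..(1 - s), (inner ℝ g (M.corner T 0 +
      s • (M.corner T 1 - M.corner T 0) + t • (M.corner T 2 - M.corner T 0)) + c)) =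
      (inner ℝ g (M.corner T 0) + c + s * inner ℝ g (M.corner T 1 - M.corner T 0)) * (1 - s) +
        inner ℝ g (M.corner T 2 - M.corner T 0) * ((1 - s) ^ 2 / 2) := by
    intro s
    have : ∀ t : ℝ, (inner ℝ g (M.corner T 0 +
      s • (M.corner T 1 - M.corner T 0) + t • (M.corner T 2 - M.corner T 0)) + c) =
      (inner ℝ g (M.corner T 0) + c + s * inner ℝ g (M.corner T 1 - M.corner T 0)) +
        inner ℝ g (M.corner T 2 - M.corner T 0) * t := by
      intro t
      rw [inner_add_right, inner_add_right, real_inner_smul_right, real_inner_smul_right]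
      ring
    simp only [this]
    rw [intervalIntegral.integral_add (Continuous.intervalIntegrable (by fun_prop) _ _)
      (Continuous.intervalIntegrable (by fun_prop) _ _), intervalIntegral.integral_const_mul,
      integral_id, intervalIntegral.integral_const]
    simp
    ring
  rw [triIntegral]
  simp only [h]
  have h2 : ∀ A B G : ℝ, (∫ s in (0 : ℝ)..1, (A + s * B) * (1 - s) + G * ((1 - s) ^ 2 / 2)) =
      A / 2 + B / 6 + G / 6 := by
    intro A B G
    have hs : ∀ s : ℝ, (A + s * B) * (1 - s) + G * ((1 - s) ^ 2 / 2) =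
        (A + G / 2) + ((B - A - G) * s + (G / 2 - B) * s ^ 2) := fun s => by ring
    have hp : ∀ P Q R : ℝ, (∫ s in (0 : ℝ)..1, P + (Q * s + R * s ^ 2)) =
        P + Q / 2 + R / 3 := by
      intro P Q R
      rw [intervalIntegral.integral_add (Continuous.intervalIntegrable (by fun_prop) _ _)
        (Continuous.intervalIntegrable (by fun_prop) _ _), intervalIntegral.integral_add
        (Continuous.intervalIntegrable (by fun_prop) _ _)
        (Continuous.intervalIntegrable (by fun_prop) _ _), intervalIntegral.integral_const_mul,
        intervalIntegral.integral_const_mul, integral_id, integral_pow,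
        intervalIntegral.integral_const]
      simp
      ring
    simp only [hs, hp]
    ring
  rw [h2, area, Fin.sum_univ_three, inner_sub_right, inner_sub_right]
  ring

theorem triIntegral_const (M : PolygonalMesh D V E C) (T : D × Bool) (c : ℝ) :
    M.triIntegral T (fun _ => c) = M.area T * c := by
  have h := M.triIntegral_affine T 0 c
  simp only [inner_zero_left, zero_add, Finset.sum_const, Finset.card_univ, Fintype.card_fin,
    nsmul_eq_mul] at h
  rw [h]
  push_cast
  ring

/-! ### Gluing of sides -/

theorem next_orig (M : PolygonalMesh D V E C) (d : D) :
    M.orig (M.next d) = M.orig (M.rev d) := by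
  refine ((M.orig_eq_iff _ _).mpr ⟨1, ?_⟩).symm
  simp [M.rev_rev]

theorem next_cell (M : PolygonalMesh D V E C) (d : D) : M.cell (M.next d) = M.cell d :=
  ((M.cell_eq_iff _ _).mpr ⟨1, by simp⟩).symm

theorem edge_rev (M : PolygonalMesh D V E C) (d : D) : M.edge (M.rev d) = M.edge d :=
  ((M.edge_eq_iff _ _).mpr (Or.inr rfl)).symm

theorem glue_glue (M : PolygonalMesh D V E C) (T : D × Bool) (a : Fin 3) :
    M.glue (M.glue T a).1 (M.glue T a).2 = (T, a) := by
  obtain ⟨d, s⟩ := T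
  revert a
  cases s <;> apply fin_three_cases <;> simp [glue, M.rev_rev]

theorem node_glue_add_one (M : PolygonalMesh D V E C) (T : D × Bool) (a : Fin 3) :
    M.node (M.glue T a).1 ((M.glue T a).2 + 1) = M.node T (a + 2) := by
  obtain ⟨d, s⟩ := T
  revert a
  -- Needed for side `2` of `(d, false)`, which is glued to a subelement of the preceding dart.
  have h1 := M.next_orig (M.next.symm d)
  have h2 := M.next_cell (M.next.symm d)
  rw [Equiv.apply_symm_apply] at h1 h2
  cases s <;> apply fin_three_cases <;>
    simp [glue, node, M.rev_rev, M.edge_rev, M.next_cell, M.next_orig, h1, h2]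

theorem node_glue_add_two (M : PolygonalMesh D V E C) (T : D × Bool) (a : Fin 3) :
    M.node (M.glue T a).1 ((M.glue T a).2 + 2) = M.node T (a + 1) := by
  have h := M.node_glue_add_one (M.glue T a).1 (M.glue T a).2
  rw [glue_glue] at h
  exact h.symm

theorem sideVector_glue (M : PolygonalMesh D V E C) (T : D × Bool) (a : Fin 3) :
    M.sideVector (M.glue T a).1 (M.glue T a).2 = -M.sideVector T a := by
  simp only [sideVector, corner, node_glue_add_one, node_glue_add_two, neg_sub]

/-- Gluing is an involution on pairs (subelement, side). This is how contributions of interior sides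
cancel on the closed surface. -/
theorem sum_glue [Fintype D] (M : PolygonalMesh D V E C) (f : D × Bool → Fin 3 → ℝ) :
    ∑ T, ∑ a, f (M.glue T a).1 (M.glue T a).2 = ∑ T, ∑ a, f T a := by
  rw [← Fintype.sum_prod_type', ← Fintype.sum_prod_type']
  have hinv : Function.Involutive fun p : (D × Bool) × Fin 3 => M.glue p.1 p.2 :=
    fun p => M.glue_glue p.1 p.2
  exact Equiv.sum_comp hinv.toPerm fun p : (D × Bool) × Fin 3 => f p.1 p.2

/-! ### Raviart-Thomas fields in terms of their side fluxes -/

/-- The piecewise Raviart-Thomas field with prescribed outward fluxes through the sides. -/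
def rtField (M : PolygonalMesh D V E C) (φ : D × Bool → Fin 3 → ℝ) : D × Bool → Space → Space :=
  fun T x => ‖M.areaVector T‖⁻¹ • ∑ a, φ T a • (x - M.corner T a)

theorem rtField_eq (M : PolygonalMesh D V E C) (φ : D × Bool → Fin 3 → ℝ) (T : D × Bool)
    (x : Space) : M.rtField φ T x =
      ‖M.areaVector T‖⁻¹ • (∑ a, φ T a • (M.corner T 0 - M.corner T a)) +
        (‖M.areaVector T‖⁻¹ * ∑ a, φ T a) • (x - M.corner T 0) := by
  rw [rtField, mul_smul, ← smul_add, Finset.sum_smul, ← Finset.sum_add_distrib]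
  congr 1
  refine Finset.sum_congr rfl fun a _ => ?_
  rw [← smul_add]
  congr 1
  abel

theorem continuous_rtField (M : PolygonalMesh D V E C) (φ : D × Bool → Fin 3 → ℝ) (T : D × Bool) :
    Continuous (M.rtField φ T) := by
  unfold rtField
  fun_prop

theorem rtField_add (M : PolygonalMesh D V E C) (φ ψ : D × Bool → Fin 3 → ℝ) (T : D × Bool)
    (x : Space) : M.rtField (φ + ψ) T x = M.rtField φ T x + M.rtField ψ T x := by
  simp only [rtField, Pi.add_apply, add_smul, Finset.sum_add_distrib, smul_add]

theorem rtField_smul (M : PolygonalMesh D V E C) (φ : D × Bool → Fin 3 → ℝ) (c : ℝ) (T : D × Bool)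
    (x : Space) : M.rtField (c • φ) T x = c • M.rtField φ T x := by
  simp only [rtField, Pi.smul_apply, smul_eq_mul, mul_smul, ← Finset.smul_sum]
  rw [smul_comm]

/-- From a point of side `a`, the directions to the two corners on that side are tangent to it, so
only the term of the opposite corner contributes. -/
theorem inner_rtField_sideNormal (M : PolygonalMesh D V E C) (φ : D × Bool → Fin 3 → ℝ)
    (T : D × Bool) (a : Fin 3) (t : ℝ) :
    inner ℝ (M.rtField φ T (M.corner T (a + 1) + t • M.sideVector T a)) (M.sideNormal T a) =
      φ T a := by
  have h := (M.norm_areaVector_pos T).ne'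
  have hb : ∀ b, inner ℝ (φ T b • (M.corner T (a + 1) + t • M.sideVector T a - M.corner T b))
      (M.sideNormal T a) = if b = a then φ T b * ‖M.areaVector T‖ else 0 := by
    intro b
    rw [add_sub_right_comm, real_inner_smul_left, inner_add_left, real_inner_smul_left,
      inner_sideVector_sideNormal, inner_sub_corner_sideNormal, mul_zero, add_zero, mul_ite,
      mul_zero]
  rw [rtField, real_inner_smul_left, sum_inner]
  simp only [hb, Finset.sum_ite_eq', Finset.mem_univ, if_true]
  field_simp

theorem inner_rtField_corner_vert (M : PolygonalMesh D V E C) (φ : D × Bool → Fin 3 → ℝ)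
    (T : D × Bool) (b : Fin 3) : inner ℝ (M.rtField φ T (M.corner T b)) (M.vert T) = 0 := by
  rw [rtField, real_inner_smul_left, sum_inner]
  simp [real_inner_smul_left, inner_corner_sub_corner_vert]

/-- A tangential field `a + b (x - p₀)` is determined by its fluxes. -/
theorem affine_eq_rtField (M : PolygonalMesh D V E C) {φ : D × Bool → Fin 3 → ℝ} {T : D × Bool}
    {v : Space} {b : ℝ} (hv : inner ℝ v (M.vert T) = 0)
    (hφ : ∀ a, inner ℝ (v + b • (M.corner T (a + 1) - M.corner T 0)) (M.sideNormal T a) = φ T a)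
    (x : Space) : v + b • (x - M.corner T 0) = M.rtField φ T x := by
  have hN := (M.norm_areaVector_pos T).ne'
  set w := ‖M.areaVector T‖⁻¹ • (∑ a, φ T a • (M.corner T 0 - M.corner T a)) with hw
  set β := ‖M.areaVector T‖⁻¹ * ∑ a, φ T a with hβ
  have hr : ∀ y, M.rtField φ T y = w + β • (y - M.corner T 0) := M.rtField_eq φ T
  have hwv : inner ℝ w (M.vert T) = 0 := by
    have := M.inner_rtField_corner_vert φ T 0
    rwa [hr, sub_self, smul_zero, add_zero] at this
  clear_value w β
  have hd : ∀ a, inner ℝ (v - w) (M.sideNormal T a) +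
      (b - β) * inner ℝ (M.corner T (a + 1) - M.corner T 0) (M.sideNormal T a) = 0 := by
    intro a
    have h1 := M.inner_rtField_sideNormal φ T a 0
    have h2 := hφ a
    rw [zero_smul, add_zero, hr, inner_add_left, real_inner_smul_left] at h1
    rw [inner_add_left, real_inner_smul_left] at h2
    rw [inner_sub_left]
    linarith
  -- Sides `1` and `2` contain corner `0`, so the linear part does not contribute to their fluxes
  -- and these fix the constant part. Side `0` then fixes the slope.
  have hvw : v - w = 0 := by
    apply M.eq_zero_of_inner_sideNormal_eq_zero (T := T)
    · rw [inner_sub_left, hv, hwv, sub_zero]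
    · have := hd 1
      rwa [inner_sub_corner_sideNormal, if_neg (by decide), mul_zero, add_zero] at this
    · have := hd 2
      rwa [inner_sub_corner_sideNormal, if_neg (by decide), mul_zero, add_zero] at this
  have hbβ : b - β = 0 := by
    have := hd 0
    rw [hvw, inner_zero_left, inner_sub_corner_sideNormal, if_pos rfl, zero_add] at this
    exact (mul_eq_zero.mp this).resolve_right hN
  rw [hr, sub_eq_zero.mp hvw, sub_eq_zero.mp hbβ]

theorem mem_side_iff (M : PolygonalMesh D V E C) (T : D × Bool) (a : Fin 3) (x : Space) :
    x ∈ M.side T a ↔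
      ∃ t ∈ Set.Icc (0 : ℝ) 1, M.corner T (a + 1) + t • M.sideVector T a = x := by
  rw [side, segment_eq_image']
  rfl

theorem corner_mem_side (M : PolygonalMesh D V E C) (T : D × Bool) (a : Fin 3) :
    M.corner T (a + 1) ∈ M.side T a := left_mem_segment ℝ _ _

theorem inner_rtField_outNormal (M : PolygonalMesh D V E C) (φ : D × Bool → Fin 3 → ℝ)
    {T : D × Bool} {a : Fin 3} {x : Space} (hx : x ∈ M.side T a) :
    inner ℝ (M.rtField φ T x) (M.outNormal T a) = ‖M.sideVector T a‖⁻¹ * φ T a := by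
  obtain ⟨t, -, rfl⟩ := (M.mem_side_iff T a x).mp hx
  rw [inner_outNormal, inner_rtField_sideNormal]

theorem sideFlux_rtField (M : PolygonalMesh D V E C) (φ : D × Bool → Fin 3 → ℝ)
    (T : D × Bool) (a : Fin 3) : M.sideFlux (M.rtField φ) T a = φ T a := by
  have h := (M.norm_sideVector_pos T a).ne'
  simp only [sideFlux, inner_outNormal, inner_rtField_sideNormal,
    intervalIntegral.integral_const, sub_zero, one_smul]
  field_simp

theorem side_glue (M : PolygonalMesh D V E C) (T : D × Bool) (a : Fin 3) :
    M.side (M.glue T a).1 (M.glue T a).2 = M.side T a := by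
  simp only [side, corner, node_glue_add_one, node_glue_add_two]
  exact segment_symm ℝ _ _

theorem isRT0_rtField (M : PolygonalMesh D V E C) {φ : D × Bool → Fin 3 → ℝ}
    (hφ : ∀ T a, φ T a + φ (M.glue T a).1 (M.glue T a).2 = 0) : M.IsRT0 (M.rtField φ) := by
  refine ⟨fun T => ⟨_, _, ?_, M.rtField_eq φ T⟩, fun T a x hx => ?_⟩
  · have := M.inner_rtField_corner_vert φ T 0
    rwa [M.rtField_eq, sub_self, smul_zero, add_zero] at this
  · have hx' := hx
    rw [← M.side_glue] at hx'
    rw [M.inner_rtField_outNormal φ hx, M.inner_rtField_outNormal φ hx', sideVector_glue, norm_neg,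
      ← mul_add, hφ, mul_zero]

theorem IsRT0.exists_eq_rtField {M : PolygonalMesh D V E C} {u : D × Bool → Space → Space}
    (hu : M.IsRT0 u) : ∃ φ : D × Bool → Fin 3 → ℝ, u = M.rtField φ ∧
      ∀ T a, φ T a + φ (M.glue T a).1 (M.glue T a).2 = 0 := by
  obtain ⟨φ, h⟩ : ∃ φ : D × Bool → Fin 3 → ℝ, u = M.rtField φ := by
    refine ⟨fun T a => inner ℝ (u T (M.corner T (a + 1))) (M.sideNormal T a), ?_⟩
    funext T x
    obtain ⟨v, b, hv, hb⟩ := hu.1 T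
    rw [hb x]
    refine M.affine_eq_rtField hv (fun a => ?_) x
    rw [hb]
  refine ⟨φ, h, fun T a => ?_⟩
  subst h
  have hx := M.corner_mem_side T a
  have hx' := hx
  rw [← M.side_glue] at hx'
  have := hu.2 T a _ hx
  rw [M.inner_rtField_outNormal φ hx, M.inner_rtField_outNormal φ hx', sideVector_glue, norm_neg,
      ← mul_add] at this
  exact (mul_eq_zero.mp this).resolve_left (inv_ne_zero (M.norm_sideVector_pos T a).ne')

/-- The field has derivative `β • id`; removing the normal direction from the trace `3 β` leaves `2
β`, and the area is half of `‖areaVector‖`. -/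
theorem div_rtField (M : PolygonalMesh D V E C) (φ : D × Bool → Fin 3 → ℝ) (T : D × Bool)
    (x : Space) : M.div (M.rtField φ) T x = (∑ a, φ T a) / M.area T := by
  have hN := (M.norm_areaVector_pos T).ne'
  set β := ‖M.areaVector T‖⁻¹ * ∑ a, φ T a with hβ
  have hr : M.rtField φ T = fun y => _ + β • (y - M.corner T 0) := funext (M.rtField_eq φ T)
  have hf : HasFDerivAt (M.rtField φ T) (β • ContinuousLinearMap.id ℝ Space) x := by
    rw [hr]
    exact (((hasFDerivAt_id x).sub_const _).const_smul β).const_add _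
  rw [div, hf.fderiv]
  have ht : LinearMap.trace ℝ Space
      ((β • ContinuousLinearMap.id ℝ Space : Space →L[ℝ] Space) : Space →ₗ[ℝ] Space) = β * 3 := by
    rw [ContinuousLinearMap.toLinearMap_smul, map_smul, ContinuousLinearMap.coe_id,
      LinearMap.trace_id]
    simp
  have hk : inner ℝ ((β • ContinuousLinearMap.id ℝ Space : Space →L[ℝ] Space) (M.vert T))
      (M.vert T) = β := by
    simp only [smul_apply, ContinuousLinearMap.id_apply]
    rw [real_inner_smul_left, inner_vert_vert, mul_one]
  rw [ht, hk, hβ, area]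
  field_simp
  ring

/-! ### Piecewise linear fields -/

/-- The piecewise linear field with prescribed values at the nodes. -/
def p1Field (M : PolygonalMesh D V E C) (val : V ⊕ (E ⊕ C) → ℝ) : D × Bool → Space → ℝ :=
  fun T x => ‖M.areaVector T‖⁻¹ *
    ∑ a, val (M.node T a) * inner ℝ (M.corner T (a + 1) - x) (M.sideNormal T a)

/-- The factor of `val (M.node T a)`, divided by `‖areaVector‖`, is the barycentric coordinate of
corner `a`. -/
theorem isP1_p1Field (M : PolygonalMesh D V E C) (val : V ⊕ (E ⊕ C) → ℝ) :
    M.IsP1 (M.p1Field val) val := by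
  constructor
  · intro T
    refine ⟨-(‖M.areaVector T‖⁻¹ • ∑ a, val (M.node T a) • M.sideNormal T a),
      ‖M.areaVector T‖⁻¹ *
        ∑ a, val (M.node T a) * inner ℝ (M.corner T (a + 1)) (M.sideNormal T a), fun x => ?_⟩
    have hc : ∀ a, inner ℝ x (M.sideNormal T a) = inner ℝ (M.sideNormal T a) x :=
      fun a => real_inner_comm _ _
    rw [inner_neg_left, real_inner_smul_left, sum_inner, p1Field]
    simp only [inner_sub_left, mul_sub, Finset.sum_sub_distrib, real_inner_smul_left, hc]
    ring
  · intro T b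
    have hN := (M.norm_areaVector_pos T).ne'
    rw [p1Field]
    simp only [inner_sub_corner_sideNormal, mul_ite, mul_zero, Finset.sum_ite_eq, Finset.mem_univ,
      if_true]
    field_simp

/-- The fluxes of the rotated gradient of a piecewise linear field. -/
def curlFlux (M : PolygonalMesh D V E C) (val : V ⊕ (E ⊕ C) → ℝ) : D × Bool → Fin 3 → ℝ :=
  fun T a => val (M.node T (a + 1)) - val (M.node T (a + 2))

theorem gradient_affine (g : Space) (c : ℝ) {f : Space → ℝ} (hf : ∀ x, f x = inner ℝ g x + c)
    (x : Space) : gradient f x = g := by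
  have : HasGradientAt f g x := by
    rw [hasGradientAt_iff_hasFDerivAt, show f = fun y => inner ℝ g y + c from funext hf]
    exact ((InnerProductSpace.toDual ℝ Space g).hasFDerivAt).add_const c
  exact this.gradient

/-- The surface gradient of a piecewise linear field is a constant tangential vector on each
subelement, which gives the differences of the values at the corners. -/
theorem IsP1.grad_eq {M : PolygonalMesh D V E C} {f : D × Bool → Space → ℝ}
    {val : V ⊕ (E ⊕ C) → ℝ} (hf : M.IsP1 f val) (T : D × Bool) :
    ∃ h : Space, (∀ x, M.grad f T x = h) ∧ inner ℝ h (M.vert T) = 0 ∧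
      ∀ a b, inner ℝ h (M.corner T a - M.corner T b) = val (M.node T a) - val (M.node T b) := by
  obtain ⟨g, c, hg⟩ := hf.1 T
  refine ⟨g - inner ℝ g (M.vert T) • M.vert T, fun x => ?_, ?_, fun a b => ?_⟩
  · rw [grad, gradient_affine g c hg]
  · rw [inner_sub_left, real_inner_smul_left, inner_vert_vert, mul_one, sub_self]
  · rw [inner_sub_left, real_inner_smul_left, real_inner_comm _ (M.vert T),
      inner_corner_sub_corner_vert, mul_zero, sub_zero, ← hf.2, ← hf.2, hg, hg, inner_sub_right]
    ring

/-- A quarter turn converts the derivative along a side into the flux through it. The field is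
constant on each subelement, hence the slope `b = 0`. -/
theorem IsP1.perp_grad {M : PolygonalMesh D V E C} {f : D × Bool → Space → ℝ}
    {val : V ⊕ (E ⊕ C) → ℝ} (hf : M.IsP1 f val) :
    M.perp (M.grad f) = M.rtField (M.curlFlux val) := by
  funext T x
  obtain ⟨h, hx, hk, hab⟩ := hf.grad_eq T
  rw [perp, hx]
  have key := M.affine_eq_rtField (φ := M.curlFlux val) (T := T) (v := cross (M.vert T) h) (b := 0)
    ?_ ?_ x
  · rwa [zero_smul, add_zero] at key
  · rw [real_inner_comm, inner_cross_self_left]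
  · intro a
    have e : inner ℝ (cross (M.vert T) h) (cross (M.sideVector T a) (M.vert T)) =
        inner ℝ h (M.vert T) * inner ℝ (M.sideVector T a) (M.vert T)
          - inner ℝ (M.vert T) (M.vert T) * inner ℝ h (M.sideVector T a) := by
      simp only [Space.inner_eq, cross_zero_coord, cross_one_coord, cross_two_coord]
      ring
    rw [zero_smul, add_zero, sideNormal, e, hk, inner_vert_vert, sideVector, hab, curlFlux]
    ring

/-- The quarter turn `k × ·` is an isometry on tangential vectors. -/
theorem IsP1.inner_grad_grad {M : PolygonalMesh D V E C} {f g : D × Bool → Space → ℝ}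
    {val val' : V ⊕ (E ⊕ C) → ℝ} (hf : M.IsP1 f val) (hg : M.IsP1 g val') [Fintype D] :
    M.innerVector (M.grad f) (M.grad g) =
      M.innerVector (M.rtField (M.curlFlux val)) (M.rtField (M.curlFlux val')) := by
  rw [← hf.perp_grad, ← hg.perp_grad, innerVector, innerVector]
  congr 1
  funext T x
  obtain ⟨h, hx, hk, -⟩ := hf.grad_eq T
  rw [perp, perp, inner_cross_cross, inner_vert_vert, hx, real_inner_comm _ (M.vert T), hk]
  ring

theorem curlFlux_glue (M : PolygonalMesh D V E C) (val : V ⊕ (E ⊕ C) → ℝ) (T : D × Bool)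
    (a : Fin 3) : M.curlFlux val T a + M.curlFlux val (M.glue T a).1 (M.glue T a).2 = 0 := by
  simp only [curlFlux, node_glue_add_one, node_glue_add_two]
  ring

theorem sum_curlFlux (M : PolygonalMesh D V E C) (val : V ⊕ (E ⊕ C) → ℝ) (T : D × Bool) :
    ∑ a, M.curlFlux val T a = 0 := by
  simp only [curlFlux, Fin.sum_univ_three, Fin.reduceAdd, zero_add]
  ring

/-- Integration by parts on a subelement. -/
theorem IsP1.triIntegral_inner_grad {M : PolygonalMesh D V E C} {f : D × Bool → Space → ℝ}
    {val : V ⊕ (E ⊕ C) → ℝ} (hf : M.IsP1 f val) (φ : D × Bool → Fin 3 → ℝ) (T : D × Bool) :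
    M.triIntegral T (fun x => inner ℝ (M.grad f T x) (M.rtField φ T x)) +
      M.triIntegral T (fun x => f T x * M.div (M.rtField φ) T x) =
        ∑ a, φ T a * ((val (M.node T (a + 1)) + val (M.node T (a + 2))) / 2) := by
  have hN := (M.norm_areaVector_pos T).ne'
  obtain ⟨h, hx, hk, hab⟩ := hf.grad_eq T
  obtain ⟨g, c, hg⟩ := hf.1 T
  have hv := hf.2 T
  -- A constant gradient paired with an RT0 field is affine, so the corner formula applies; the
  -- corner values are then read off by undoing the rewriting.
  have h1 : M.triIntegral T (fun x => inner ℝ (M.grad f T x) (M.rtField φ T x)) =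
      M.area T / 3 * ∑ b, ‖M.areaVector T‖⁻¹ *
        ∑ a, φ T a * (val (M.node T b) - val (M.node T a)) := by
    have e : ∀ x, inner ℝ (M.grad f T x) (M.rtField φ T x) =
        inner ℝ ((‖M.areaVector T‖⁻¹ * ∑ a, φ T a) • h) x +
          (-(‖M.areaVector T‖⁻¹ * ∑ a, φ T a * inner ℝ h (M.corner T a))) := by
      intro x
      rw [hx, rtField, real_inner_smul_right, inner_sum, real_inner_smul_left]
      simp only [real_inner_smul_right, inner_sub_right, mul_sub, Finset.sum_sub_distrib,
        ← Finset.sum_mul]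
      ring
    simp only [e, triIntegral_affine]
    congr 1
    refine Finset.sum_congr rfl fun b _ => ?_
    rw [← e, hx, rtField, real_inner_smul_right, inner_sum]
    simp only [real_inner_smul_right, hab]
  have h2 : M.triIntegral T (fun x => f T x * M.div (M.rtField φ) T x) =
      (∑ a, φ T a) / M.area T * (M.area T / 3 * ∑ b, val (M.node T b)) := by
    simp only [div_rtField, mul_comm (f T _), triIntegral_const_mul]
    have : f T = fun x => inner ℝ g x + c := funext hg
    rw [this, triIntegral_affine]
    simp only [← hg, hv]
  rw [h1, h2, area]
  simp only [Fin.sum_univ_three, Fin.reduceAdd, zero_add]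
  field_simp
  ring

/-- Integration by parts on the closed surface. -/
theorem IsP1.innerVector_grad {M : PolygonalMesh D V E C} [Fintype D] {f : D × Bool → Space → ℝ}
    {val : V ⊕ (E ⊕ C) → ℝ} (hf : M.IsP1 f val) {φ : D × Bool → Fin 3 → ℝ}
    (hφ : ∀ T a, φ T a + φ (M.glue T a).1 (M.glue T a).2 = 0) :
    M.innerVector (M.grad f) (M.rtField φ) = -M.innerScalar f (M.div (M.rtField φ)) := by
  rw [eq_neg_iff_add_eq_zero, innerVector, innerScalar, integral, integral,
    ← Finset.sum_add_distrib]
  simp only [hf.triIntegral_inner_grad φ]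
  set F : D × Bool → Fin 3 → ℝ := fun T a =>
    φ T a * ((val (M.node T (a + 1)) + val (M.node T (a + 2))) / 2) with hF
  -- Across a side the flux changes sign while the mean of the two nodal values is shared, so the
  -- total equals its own negative.
  have h : ∑ T, ∑ a, F (M.glue T a).1 (M.glue T a).2 = -∑ T, ∑ a, F T a := by
    simp only [← Finset.sum_neg_distrib]
    refine Finset.sum_congr rfl fun T _ => Finset.sum_congr rfl fun a _ => ?_
    simp only [hF, node_glue_add_one, node_glue_add_two]
    linear_combination ((val (M.node T (a + 1)) + val (M.node T (a + 2))) / 2) * hφ T a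
  rw [sum_glue] at h
  change ∑ T, ∑ a, F T a = 0
  linarith

/-! ### Sums over darts and functions on cells -/

theorem eq_of_cell_eq [Finite D] {α : Type*} (M : PolygonalMesh D V E C) {f : D → α}
    (hf : ∀ d, f (M.next d) = f d) {d d' : D} (h : M.cell d = M.cell d') : f d = f d' := by
  obtain ⟨n, -, rfl⟩ := ((M.cell_eq_iff d d').mp h).exists_pow_eq'
  clear h
  induction n with
  | zero => rfl
  | succ n ih => rw [pow_succ', Equiv.Perm.mul_apply, hf, ih]

theorem sum_next [Fintype D] [DecidableEq C] (M : PolygonalMesh D V E C) (f : D → ℝ) (c : C) :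
    (∑ d, if M.cell d = c then f (M.next d) else 0) = ∑ d, if M.cell d = c then f d else 0 := by
  rw [← Equiv.sum_comp M.next fun d => if M.cell d = c then f d else 0]
  simp only [next_cell]

theorem eq_pos_or_eq_rev_pos (M : PolygonalMesh D V E C) (d : D) :
    d = M.pos (M.edge d) ∨ d = M.rev (M.pos (M.edge d)) :=
  (M.edge_eq_iff _ _).mp (M.edge_pos (M.edge d))

theorem sum_darts [Fintype D] [Fintype E] (M : PolygonalMesh D V E C) (f : D → ℝ) :
    ∑ d, f d = ∑ e, (f (M.pos e) + f (M.rev (M.pos e))) := by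
  classical
  rw [← Finset.sum_fiberwise Finset.univ M.edge f]
  refine Finset.sum_congr rfl fun e _ => ?_
  rw [← Finset.sum_pair (M.rev_ne (M.pos e)).symm]
  refine Finset.sum_congr ?_ fun _ _ => rfl
  ext d
  simp only [Finset.mem_filter, Finset.mem_univ, true_and, Finset.mem_insert, Finset.mem_singleton]
  rw [← M.edge_eq_iff, M.edge_pos, eq_comm]

/-- The nested cases form a difference of indicators because the two sides of an edge are different
cells. -/
theorem D₂_apply [DecidableEq C] (M : PolygonalMesh D V E C) (i : C) (e : E) :
    M.D₂ i e = (if M.cell (M.pos e) = i then 1 else 0) -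
      (if M.cell (M.rev (M.pos e)) = i then 1 else 0) := by
  have h := M.cell_rev_ne (M.pos e)
  simp only [D₂, Matrix.of_apply]
  split_ifs with h1 h2 <;> simp_all

theorem D₁_apply [DecidableEq V] (M : PolygonalMesh D V E C) (e : E) (j : V) :
    M.D₁ e j = (if M.orig (M.rev (M.pos e)) = j then 1 else 0) -
      (if M.orig (M.pos e) = j then 1 else 0) := by
  have h := M.orig_rev_ne (M.pos e)
  simp only [D₁, Matrix.of_apply]
  split_ifs with h1 h2 <;> simp_all

theorem sum_D₂_mul [Fintype D] [Fintype E] [DecidableEq C] (M : PolygonalMesh D V E C) {h : D → ℝ}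
    (hh : ∀ d, h (M.rev d) = -h d) (i : C) :
    ∑ e, M.D₂ i e * h (M.pos e) = ∑ d, if M.cell d = i then h d else 0 := by
  rw [M.sum_darts]
  refine Finset.sum_congr rfl fun e _ => ?_
  rw [D₂_apply, hh]
  split_ifs <;> ring

/-- The boundary of a boundary vanishes. -/
theorem D₂_mul_D₁ [Fintype D] [Fintype E] [DecidableEq C] [DecidableEq V]
    (M : PolygonalMesh D V E C) : M.D₂ * M.D₁ = 0 := by
  ext i j
  rw [Matrix.mul_apply, Matrix.zero_apply]
  simp only [D₁_apply]
  rw [M.sum_D₂_mul (h := fun d => (if M.orig (M.rev d) = j then 1 else 0) -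
    (if M.orig d = j then (1 : ℝ) else 0)) (fun d => by simp only [M.rev_rev]; ring)]
  -- Each dart ends where the next one starts, so the differences telescope around the cell.
  have h := M.sum_next (fun d => if M.orig d = j then (1 : ℝ) else 0) i
  simp only [next_orig] at h
  rw [← sub_eq_zero, ← Finset.sum_sub_distrib] at h
  refine (Finset.sum_congr rfl fun d _ => ?_).trans h
  split_ifs <;> ring

/-- A function on the darts whose sum over each cell vanishes is a difference along the
cycles that bound the cells. -/
theorem exists_next_sub_eq [Fintype D] [DecidableEq C] (M : PolygonalMesh D V E C) (H : D → ℝ)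
    (hH : ∀ c, (∑ d, if M.cell d = c then H d else 0) = 0) :
    ∃ F : D → ℝ, ∀ d, F (M.next d) = F d + H d := by
  -- `S k d` sums `H` over `k` successive darts from `d`. The witness is minus the average of `S k`
  -- over a full period, which treats all darts alike and needs no base dart in each cell.
  set N := orderOf M.next with hN
  have hNpos : (0 : ℝ) < N := Nat.cast_pos.mpr (orderOf_pos _)
  set S : ℕ → D → ℝ := fun k d => ∑ i ∈ Finset.range k, H ((M.next ^ i) d) with hS
  have hstep : ∀ k d, S k (M.next d) = S (k + 1) d - H d := by
    intro k d
    simp only [hS, Finset.sum_range_succ', pow_zero, Equiv.Perm.one_apply, pow_succ,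
      Equiv.Perm.mul_apply, add_sub_cancel_right]
  have hSN_next : ∀ d, S N (M.next d) = S N d := by
    intro d
    rw [hstep]
    simp only [hS, Finset.sum_range_succ, hN, pow_orderOf_eq_one, Equiv.Perm.one_apply,
      add_sub_cancel_right]
  have hpow : ∀ (i : ℕ) (c : C),
      (∑ d, if M.cell d = c then H ((M.next ^ i) d) else 0) = 0 := by
    intro i c
    induction i with
    | zero => exact hH c
    | succ i ih =>
      refine (Finset.sum_congr rfl fun d _ => ?_).trans
        ((M.sum_next (fun d => H ((M.next ^ i) d)) c).trans ih)
      rw [pow_succ, Equiv.Perm.mul_apply]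
  -- `S N` is constant on each cell, and its sum over the darts of a cell is `N` copies of the
  -- vanishing sum of `H`.
  have hSN : ∀ d, S N d = 0 := by
    intro d
    have h1 : (∑ d', if M.cell d' = M.cell d then S N d' else 0) = 0 := by
      have : ∀ d', (if M.cell d' = M.cell d then S N d' else 0) =
          ∑ i ∈ Finset.range N, if M.cell d' = M.cell d then H ((M.next ^ i) d') else 0 := by
        intro d'
        split_ifs
        · rfl
        · simp
      simp only [this]
      rw [Finset.sum_comm]
      exact Finset.sum_eq_zero fun i _ => hpow i _
    have h2 : ∀ d', (if M.cell d' = M.cell d then S N d' else 0) =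
        S N d * if M.cell d' = M.cell d then 1 else 0 := by
      intro d'
      split_ifs with h
      · rw [M.eq_of_cell_eq hSN_next h, mul_one]
      · rw [mul_zero]
    simp only [h2, ← Finset.mul_sum] at h1
    refine (mul_eq_zero.mp h1).resolve_right (ne_of_gt ?_)
    refine Finset.sum_pos' (fun d' _ => by split_ifs <;> norm_num) ⟨d, Finset.mem_univ _, ?_⟩
    rw [if_pos rfl]
    exact one_pos
  refine ⟨fun d => -((N : ℝ)⁻¹ * ∑ k ∈ Finset.range N, S k d), fun d => ?_⟩
  have h3 : ∑ k ∈ Finset.range N, S k (M.next d) = ∑ k ∈ Finset.range N, S k d - N * H d := by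
    simp only [hstep, Finset.sum_sub_distrib, Finset.sum_const, Finset.card_range, nsmul_eq_mul]
    have h4 := Finset.sum_range_succ (fun k => S k d) N
    rw [Finset.sum_range_succ', hSN] at h4
    have h5 : S 0 d = 0 := by simp [hS]
    rw [h5] at h4
    linarith
  beta_reduce
  rw [h3]
  field_simp
  ring

/-! ### Fields with given outer fluxes -/

/-- The flux through the primal edge of a dart, out of the cell on its left. -/
def outerFlux (φ : D × Bool → Fin 3 → ℝ) (d : D) : ℝ := φ (d, false) 0 + φ (d, true) 0

theorem edgeFlux_rtField (M : PolygonalMesh D V E C) (φ : D × Bool → Fin 3 → ℝ) (e : E) :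
    M.edgeFlux (M.rtField φ) e = outerFlux φ (M.pos e) := by
  simp only [edgeFlux, sideFlux_rtField, Fintype.sum_bool, outerFlux]
  ring

theorem outerFlux_rev {M : PolygonalMesh D V E C} {φ : D × Bool → Fin 3 → ℝ}
    (hφ : ∀ T a, φ T a + φ (M.glue T a).1 (M.glue T a).2 = 0) (d : D) :
    outerFlux φ (M.rev d) = -outerFlux φ d := by
  have h1 := hφ (d, false) 0
  have h2 := hφ (d, true) 0
  simp only [glue] at h1 h2
  simp only [outerFlux]
  linarith

theorem sum_subelements [Fintype D] [DecidableEq C] (M : PolygonalMesh D V E C) (c : C)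
    (f : D × Bool → ℝ) : (∑ T : D × Bool, if M.cell T.1 = c then f T else 0) =
      ∑ d, if M.cell d = c then f (d, false) + f (d, true) else 0 := by
  rw [Fintype.sum_prod_type]
  refine Finset.sum_congr rfl fun d _ => ?_
  rw [Fintype.sum_bool]
  split_ifs <;> ring

/-- The divergence theorem on a cell. -/
theorem sum_cell_flux [Fintype D] [DecidableEq C] {M : PolygonalMesh D V E C}
    {φ : D × Bool → Fin 3 → ℝ} (hφ : ∀ T a, φ T a + φ (M.glue T a).1 (M.glue T a).2 = 0) (c : C) :
    (∑ T : D × Bool, if M.cell T.1 = c then ∑ a, φ T a else 0) =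
      ∑ d, if M.cell d = c then outerFlux φ d else 0 := by
  rw [sum_subelements]
  -- Fluxes through the sides inside a cell cancel: those to edge points within one dart, those to
  -- vertices between a dart and its successor.
  have h := M.sum_next (fun d => φ (d, false) 2) c
  rw [← sub_eq_zero, ← Finset.sum_sub_distrib] at h ⊢
  rw [← neg_eq_zero, ← Finset.sum_neg_distrib]
  refine (Finset.sum_congr rfl fun d _ => ?_).trans h
  have h1 := hφ (d, false) 1
  have h2 := hφ (d, true) 1
  simp only [glue] at h1 h2
  simp only [outerFlux, Fin.sum_univ_three]
  split_ifs <;> linarith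

theorem cellArea_pos [Fintype D] [DecidableEq C] (M : PolygonalMesh D V E C) (c : C) :
    0 < M.cellArea c := by
  obtain ⟨d, rfl⟩ := M.cell_surjective c
  refine Finset.sum_pos' (fun T _ => ?_) ⟨(d, false), Finset.mem_univ _, ?_⟩
  · split_ifs
    · exact (M.area_pos T).le
    · exact le_rfl
  · rw [if_pos rfl]
    exact M.area_pos _

/-! ### Interior piecewise linear fields -/

/-- Nodal values that vanish on the cell boundaries. -/
def interiorVal (l : C → ℝ) : V ⊕ (E ⊕ C) → ℝ := Sum.elim 0 (Sum.elim 0 l)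

theorem isInteriorP1_iff (M : PolygonalMesh D V E C) (g : D × Bool → Space → ℝ) :
    M.IsInteriorP1 g ↔ ∃ l, M.IsP1 g (interiorVal l) := by
  constructor
  · rintro ⟨val, hg, hV, hE⟩
    refine ⟨fun c => val (Sum.inr (Sum.inr c)), ?_⟩
    convert hg using 1
    ext x
    rcases x with j | e | c
    · exact (hV j).symm
    · exact (hE e).symm
    · rfl
  · rintro ⟨l, hg⟩
    exact ⟨_, hg, fun _ => rfl, fun _ => rfl⟩

/-- Only corner `0`, the dual vertex, has a nonzero value: the flux circulates about it without
crossing primal edges. -/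
theorem curlFlux_interiorVal (M : PolygonalMesh D V E C) (l : C → ℝ) (T : D × Bool) :
    M.curlFlux (interiorVal l) T = ![0, -l (M.cell T.1), l (M.cell T.1)] := by
  obtain ⟨d, s⟩ := T
  ext a
  revert a
  cases s <;> apply fin_three_cases <;> simp [curlFlux, node, interiorVal]

theorem rtField_interiorVal (M : PolygonalMesh D V E C) (l : C → ℝ) (T : D × Bool) (x : Space) :
    M.rtField (M.curlFlux (interiorVal l)) T x =
      -((l (M.cell T.1) * ‖M.areaVector T‖⁻¹) • M.sideVector T 0) := by
  rw [rtField, curlFlux_interiorVal, Fin.sum_univ_three]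
  simp only [Matrix.cons_val, sideVector, zero_add, zero_smul, neg_smul, smul_add, smul_sub,
    smul_neg, smul_smul]
  rw [mul_comm]
  abel

theorem curlFlux_add (M : PolygonalMesh D V E C) (val val' : V ⊕ (E ⊕ C) → ℝ) :
    M.curlFlux (val + val') = M.curlFlux val + M.curlFlux val' := by
  ext T a
  simp only [curlFlux, Pi.add_apply]
  ring

/-! ### Linearity of the inner product -/

theorem innerVector_rtField_add [Fintype D] (M : PolygonalMesh D V E C)
    (φ ψ : D × Bool → Fin 3 → ℝ) {w : D × Bool → Space → Space} (hw : ∀ T, Continuous (w T)) :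
    M.innerVector (M.rtField (φ + ψ)) w =
      M.innerVector (M.rtField φ) w + M.innerVector (M.rtField ψ) w := by
  simp only [innerVector, integral, ← Finset.sum_add_distrib, rtField_add, inner_add_left]
  exact Finset.sum_congr rfl fun T _ => M.triIntegral_add T
    ((M.continuous_rtField φ T).inner (hw T)) ((M.continuous_rtField ψ T).inner (hw T))

theorem innerVector_rtField_smul [Fintype D] (M : PolygonalMesh D V E C) (c : ℝ)
    (φ : D × Bool → Fin 3 → ℝ) (w : D × Bool → Space → Space) :
    M.innerVector (M.rtField (c • φ)) w = c * M.innerVector (M.rtField φ) w := by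
  simp only [innerVector, integral, rtField_smul, real_inner_smul_left, triIntegral_const_mul,
    Finset.mul_sum]

theorem innerVector_rtField_sum [Fintype D] (M : PolygonalMesh D V E C) {ι : Type*} (s : Finset ι)
    (φ : ι → D × Bool → Fin 3 → ℝ) {w : D × Bool → Space → Space} (hw : ∀ T, Continuous (w T)) :
    M.innerVector (M.rtField (∑ i ∈ s, φ i)) w = ∑ i ∈ s, M.innerVector (M.rtField (φ i)) w := by
  classical
  induction s using Finset.induction_on with
  | empty =>
    have h := M.innerVector_rtField_smul 0 0 w
    simpa using h
  | insert i s hi ih => rw [Finset.sum_insert hi, Finset.sum_insert hi, ← ih,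
      M.innerVector_rtField_add _ _ hw]

/-- The equations decouple over the fibres of `c`; each is linear in one unknown with coefficient `∑
q > 0`, the fibre being nonempty. -/
theorem exists_sum_mul_add_eq_zero {ι κ : Type*} [Fintype ι] [Fintype κ] (c : ι → κ)
    (hc : Function.Surjective c) (p : ι → ℝ) {q : ι → ℝ} (hq : ∀ i, 0 < q i) :
    ∃ m : κ → ℝ, ∀ l : κ → ℝ, ∑ i, l (c i) * (p i + m (c i) * q i) = 0 := by
  classical
  refine ⟨fun k => -(∑ i with c i = k, p i) / ∑ i with c i = k, q i, fun l => ?_⟩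
  rw [← Finset.sum_fiberwise Finset.univ c]
  refine Finset.sum_eq_zero fun k _ => ?_
  have hpos : 0 < ∑ i with c i = k, q i := by
    obtain ⟨i, rfl⟩ := hc k
    exact Finset.sum_pos (fun i _ => hq i) ⟨i, by simp⟩
  have h : ∀ i ∈ Finset.univ.filter (fun i => c i = k), l (c i) * (p i +
      -(∑ i' with c i' = c i, p i') / (∑ i' with c i' = c i, q i') * q i) =
      l k * (p i + -(∑ i' with c i' = k, p i') / (∑ i' with c i' = k, q i') * q i) := by
    intro i hi
    rw [(Finset.mem_filter.mp hi).2]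
  rw [Finset.sum_congr rfl h, ← Finset.mul_sum, Finset.sum_add_distrib, ← Finset.mul_sum]
  field_simp
  ring

/-- There is one interior node per cell, and interior fields of different cells have disjoint
supports, so the Galerkin system is diagonal with positive entries. -/
theorem exists_interior_correction [Fintype D] [Fintype C] (M : PolygonalMesh D V E C)
    (φ : D × Bool → Fin 3 → ℝ) : ∃ m : C → ℝ, ∀ l : C → ℝ,
      M.innerVector (M.rtField (φ + M.curlFlux (interiorVal m)))
        (M.rtField (M.curlFlux (interiorVal l))) = 0 := by
  set s : D × Bool → Space := fun T => -(‖M.areaVector T‖⁻¹ • M.sideVector T 0) with hs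
  have hr : ∀ (l : C → ℝ) T x,
      M.rtField (M.curlFlux (interiorVal l)) T x = l (M.cell T.1) • s T := by
    intro l T x
    rw [rtField_interiorVal, hs, smul_neg, smul_smul]
  have hq : ∀ T, 0 < M.area T * inner ℝ (s T) (s T) := by
    intro T
    refine mul_pos (M.area_pos T) (real_inner_self_pos.mpr (neg_ne_zero.mpr ?_))
    exact smul_ne_zero (inv_ne_zero (M.norm_areaVector_pos T).ne') (M.sideVector_ne_zero T 0)
  obtain ⟨m, hm⟩ := exists_sum_mul_add_eq_zero (fun T : D × Bool => M.cell T.1)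
    (fun c => (M.cell_surjective c).elim fun d hd => ⟨(d, false), hd⟩)
    (fun T => M.triIntegral T fun x => inner ℝ (M.rtField φ T x) (s T)) hq
  refine ⟨m, fun l => ?_⟩
  rw [← hm l, innerVector, integral]
  refine Finset.sum_congr rfl fun T _ => ?_
  have hc := M.continuous_rtField φ T
  simp only [rtField_add, hr, real_inner_smul_right, inner_add_left]
  rw [M.triIntegral_add T (by fun_prop) (by fun_prop), triIntegral_const, triIntegral_const_mul,
    real_inner_smul_left]
  ring

/-! ### Harmonic fluxes -/

/-- The conditions on the fluxes of the fields in the span of the velocity basis functions. -/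
structure IsHarmonicFlux [Fintype D] (M : PolygonalMesh D V E C) (φ : D × Bool → Fin 3 → ℝ) :
    Prop where
  glue : ∀ T a, φ T a + φ (M.glue T a).1 (M.glue T a).2 = 0
  edge : ∃ κ : E → ℝ, ∀ e s, φ (M.pos e, s) 0 = κ e * ‖M.sideVector (M.pos e, s) 0‖
  cell : ∃ δ : C → ℝ, ∀ T, ∑ a, φ T a = δ (M.cell T.1) * M.area T
  orth : ∀ l, M.innerVector (M.rtField φ) (M.rtField (M.curlFlux (interiorVal l))) = 0

theorem IsHarmonicFlux.add [Fintype D] {M : PolygonalMesh D V E C} {φ ψ : D × Bool → Fin 3 → ℝ}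
    (hφ : M.IsHarmonicFlux φ) (hψ : M.IsHarmonicFlux ψ) : M.IsHarmonicFlux (φ + ψ) := by
  obtain ⟨κ, hκ⟩ := hφ.edge
  obtain ⟨κ', hκ'⟩ := hψ.edge
  obtain ⟨δ, hδ⟩ := hφ.cell
  obtain ⟨δ', hδ'⟩ := hψ.cell
  refine ⟨fun T a => ?_, ⟨κ + κ', fun e s => ?_⟩, ⟨δ + δ', fun T => ?_⟩, fun l => ?_⟩
  · simp only [Pi.add_apply]
    linarith [hφ.glue T a, hψ.glue T a]
  · simp only [Pi.add_apply, hκ, hκ', add_mul]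
  · simp only [Pi.add_apply, Finset.sum_add_distrib, hδ, hδ', add_mul]
  · rw [M.innerVector_rtField_add _ _ (M.continuous_rtField _), hφ.orth, hψ.orth, add_zero]

theorem IsHarmonicFlux.smul [Fintype D] {M : PolygonalMesh D V E C} {φ : D × Bool → Fin 3 → ℝ}
    (c : ℝ) (hφ : M.IsHarmonicFlux φ) : M.IsHarmonicFlux (c • φ) := by
  obtain ⟨κ, hκ⟩ := hφ.edge
  obtain ⟨δ, hδ⟩ := hφ.cell
  refine ⟨fun T a => ?_, ⟨c • κ, fun e s => ?_⟩, ⟨c • δ, fun T => ?_⟩, fun l => ?_⟩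
  · simp only [Pi.smul_apply, smul_eq_mul, ← mul_add, hφ.glue T a, mul_zero]
  · simp only [Pi.smul_apply, smul_eq_mul, hκ, mul_assoc]
  · simp only [Pi.smul_apply, smul_eq_mul, ← Finset.mul_sum, hδ, mul_assoc]
  · rw [innerVector_rtField_smul, hφ.orth, mul_zero]

theorem isHarmonicFlux_zero [Fintype D] (M : PolygonalMesh D V E C) : M.IsHarmonicFlux 0 := by
  refine ⟨by simp, ⟨0, by simp⟩, ⟨0, by simp⟩, fun l => ?_⟩
  have := M.innerVector_rtField_smul 0 0 (M.rtField (M.curlFlux (interiorVal l)))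
  simpa using this

theorem IsHarmonicFlux.sum [Fintype D] {M : PolygonalMesh D V E C} {ι : Type*} {s : Finset ι}
    {φ : ι → D × Bool → Fin 3 → ℝ} (hφ : ∀ i ∈ s, M.IsHarmonicFlux (φ i)) :
    M.IsHarmonicFlux (∑ i ∈ s, φ i) :=
  Finset.sum_induction φ M.IsHarmonicFlux (fun _ _ => IsHarmonicFlux.add)
    M.isHarmonicFlux_zero hφ

/-- Fluxes without divergence and without flux through the cell boundaries are those of a rotated
gradient of an interior piecewise linear field. -/
theorem exists_eq_curlFlux [Finite D] {M : PolygonalMesh D V E C} {φ : D × Bool → Fin 3 → ℝ}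
    (hφ : ∀ T a, φ T a + φ (M.glue T a).1 (M.glue T a).2 = 0) (h0 : ∀ T, φ T 0 = 0)
    (hd : ∀ T, ∑ a, φ T a = 0) : ∃ l : C → ℝ, φ = M.curlFlux (interiorVal l) := by
  simp only [Fin.sum_univ_three, h0, zero_add] at hd
  have h1 : ∀ d, φ (d, true) 2 = φ (d, false) 2 := by
    intro d
    have := hφ (d, false) 1
    simp only [glue] at this
    linarith [hd (d, false)]
  have h2 : ∀ d, φ (M.next d, false) 2 = φ (d, false) 2 := by
    intro d
    have := hφ (d, true) 1
    simp only [glue] at this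
    linarith [hd (d, true), h1 d]
  -- The circulating flux is the same through every spoke of a cell; this common value serves as the
  -- dual vertex value.
  refine ⟨fun c => φ (Function.surjInv M.cell_surjective c, false) 2, ?_⟩
  ext ⟨d, s⟩ a
  have h3 : φ (Function.surjInv M.cell_surjective (M.cell d), false) 2 = φ (d, false) 2 :=
    M.eq_of_cell_eq (f := fun d => φ (d, false) 2) h2 (Function.surjInv_eq _ _)
  rw [curlFlux_interiorVal]
  simp only [h3]
  have h4 := hd (d, s)
  have h5 : φ (d, s) 2 = φ (d, false) 2 := by
    cases s
    · rfl
    · exact h1 d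
  revert a
  apply fin_three_cases
  · simp [h0]
  · simp only [Matrix.cons_val]
    linarith
  · simpa using h5

/-- A field in the span of the velocity basis functions is determined by its fluxes through the
primal edges. -/
theorem IsHarmonicFlux.rtField_eq_zero [Fintype D] [DecidableEq C] {M : PolygonalMesh D V E C}
    {φ : D × Bool → Fin 3 → ℝ} (hφ : M.IsHarmonicFlux φ)
    (h : ∀ e, outerFlux φ (M.pos e) = 0) (T : D × Bool) (x : Space) : M.rtField φ T x = 0 := by
  obtain ⟨κ, hκ⟩ := hφ.edge
  obtain ⟨δ, hδ⟩ := hφ.cell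
  -- The fluxes through the two halves have the same sign, so a zero total makes both vanish.
  have hκ0 : ∀ e, κ e = 0 := by
    intro e
    have := h e
    rw [outerFlux, hκ, hκ, ← mul_add] at this
    exact (mul_eq_zero.mp this).resolve_right
      (add_pos (M.norm_sideVector_pos _ _) (M.norm_sideVector_pos _ _)).ne'
  have hp : ∀ e s, φ (M.pos e, s) 0 = 0 := fun e s => by rw [hκ, hκ0, zero_mul]
  have h0 : ∀ T, φ T 0 = 0 := by
    rintro ⟨d, s⟩
    rcases M.eq_pos_or_eq_rev_pos d with hd | hd
    · rw [hd, hp]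
    · have := hφ.glue (d, s) 0
      rw [hd] at this ⊢
      cases s <;> simpa [PolygonalMesh.glue, M.rev_rev, hp] using this
  have hδ0 : ∀ c, δ c = 0 := by
    intro c
    have h1 := sum_cell_flux hφ.glue c
    simp only [outerFlux, h0, hδ, add_zero, ite_self, Finset.sum_const_zero] at h1
    have h2 : (∑ T : D × Bool, if M.cell T.1 = c then δ (M.cell T.1) * M.area T else 0) =
        δ c * M.cellArea c := by
      rw [cellArea, Finset.mul_sum]
      refine Finset.sum_congr rfl fun T _ => ?_
      split_ifs with hT
      · rw [hT]
      · rw [mul_zero]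
    rw [h2] at h1
    exact (mul_eq_zero.mp h1).resolve_right (M.cellArea_pos c).ne'
  obtain ⟨l, rfl⟩ := exists_eq_curlFlux hφ.glue h0 (fun T => by rw [hδ, hδ0, zero_mul])
  -- The field is itself one of the test fields, so its squared norm vanishes.
  have ho := hφ.orth l
  simp only [innerVector, integral, rtField_interiorVal, triIntegral_const] at ho
  have hT := (Finset.sum_eq_zero_iff_of_nonneg fun T _ =>
    mul_nonneg (M.area_pos T).le real_inner_self_nonneg).mp ho T (Finset.mem_univ _)
  rw [rtField_interiorVal]
  exact inner_self_eq_zero.mp ((mul_eq_zero.mp hT).resolve_left (M.area_pos T).ne')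

/-! ### The velocity basis functions -/

theorem IsVelocityBasis.exists_harmonicFlux [Fintype D] [DecidableEq E] {M : PolygonalMesh D V E C}
    {e : E} {u : D × Bool → Space → Space} (hu : M.IsVelocityBasis e u) :
    ∃ φ, u = M.rtField φ ∧ M.IsHarmonicFlux φ ∧
      ∀ e', outerFlux φ (M.pos e') = if e' = e then 1 else 0 := by
  obtain ⟨hrt, hedge, hflux, ⟨δ, hδ⟩, horth⟩ := hu
  obtain ⟨φ, rfl, hφ⟩ := hrt.exists_eq_rtField
  choose c hc using hedge
  refine ⟨φ, rfl, ⟨hφ, ⟨c, fun e' s => ?_⟩, ⟨δ, fun T => ?_⟩, fun l => ?_⟩, fun e' => ?_⟩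
  · have hs := (M.norm_sideVector_pos (M.pos e', s) 0).ne'
    rw [← hc e' s _ (M.corner_mem_side _ _), M.inner_rtField_outNormal φ (M.corner_mem_side _ _)]
    field_simp
  · have ha := (M.area_pos T).ne'
    rw [← hδ T 0, div_rtField]
    field_simp
  · have hg := M.isP1_p1Field (interiorVal l)
    rw [← hg.perp_grad]
    exact horth _ ((M.isInteriorP1_iff _).mpr ⟨l, hg⟩)
  · rw [← edgeFlux_rtField, hflux]

theorem IsHarmonicFlux.isVelocityBasis [Fintype D] [DecidableEq E] {M : PolygonalMesh D V E C}
    {e : E} {φ : D × Bool → Fin 3 → ℝ} (hφ : M.IsHarmonicFlux φ)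
    (he : ∀ e', outerFlux φ (M.pos e') = if e' = e then 1 else 0) :
    M.IsVelocityBasis e (M.rtField φ) := by
  obtain ⟨κ, hκ⟩ := hφ.edge
  obtain ⟨δ, hδ⟩ := hφ.cell
  refine ⟨M.isRT0_rtField hφ.glue, fun e' => ⟨κ e', fun s x hx => ?_⟩, fun e' => ?_,
    ⟨δ, fun T x => ?_⟩, fun g hg => ?_⟩
  · have hs := (M.norm_sideVector_pos (M.pos e', s) 0).ne'
    rw [M.inner_rtField_outNormal φ hx, hκ]
    field_simp
  · rw [edgeFlux_rtField, he]
  · have ha := (M.area_pos T).ne'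
    rw [div_rtField, hδ]
    field_simp
  · obtain ⟨l, hl⟩ := (M.isInteriorP1_iff g).mp hg
    rw [hl.perp_grad, hφ.orth]

theorem norm_sideVector_rev (M : PolygonalMesh D V E C) (d : D) (s : Bool) :
    ‖M.sideVector (M.rev d, s) 0‖ = ‖M.sideVector (d, !s) 0‖ := by
  have h := M.sideVector_glue (d, !s) 0
  cases s <;> simp only [glue, Bool.not_true, Bool.not_false] at h ⊢ <;> rw [h, norm_neg]

/-- Fluxes with prescribed total flux through each primal edge, for which the divergence is constant
on each cell. -/
theorem exists_flux [Fintype D] (M : PolygonalMesh D V E C) {σ : D → ℝ}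
    (hσ : ∀ d, σ (M.rev d) = -σ d) : ∃ φ : D × Bool → Fin 3 → ℝ,
      (∀ T a, φ T a + φ (M.glue T a).1 (M.glue T a).2 = 0) ∧
      (∃ κ : E → ℝ, ∀ e s, φ (M.pos e, s) 0 = κ e * ‖M.sideVector (M.pos e, s) 0‖) ∧
      (∃ δ : C → ℝ, ∀ T, ∑ a, φ T a = δ (M.cell T.1) * M.area T) ∧
      ∀ d, outerFlux φ d = σ d := by
  classical
  set L : D → ℝ := fun d => ‖M.sideVector (d, false) 0‖ + ‖M.sideVector (d, true) 0‖ with hL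
  have hLpos : ∀ d, 0 < L d := fun d =>
    add_pos (M.norm_sideVector_pos _ _) (M.norm_sideVector_pos _ _)
  have hLrev : ∀ d, L (M.rev d) = L d := by
    intro d
    simp only [hL, norm_sideVector_rev, Bool.not_true, Bool.not_false]
    ring
  -- The divergence theorem forces this value, and it is exactly what makes the difference equation
  -- for `F` solvable.
  set δ : C → ℝ := fun c => (∑ d, if M.cell d = c then σ d else 0) / M.cellArea c with hδ
  obtain ⟨F, hF⟩ := M.exists_next_sub_eq
    (fun d => σ d - δ (M.cell d) * (M.area (d, false) + M.area (d, true))) (by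
      intro c
      have h : ∀ d, (if M.cell d = c then
          σ d - δ (M.cell d) * (M.area (d, false) + M.area (d, true)) else 0) =
          (if M.cell d = c then σ d else 0) -
            δ c * (if M.cell d = c then M.area (d, false) + M.area (d, true) else 0) := by
        intro d
        split_ifs with hd
        · rw [hd]
        · ring
      simp only [h]
      rw [Finset.sum_sub_distrib, ← Finset.mul_sum, ← sum_subelements, ← cellArea, hδ,
        div_mul_cancel₀ _ (M.cellArea_pos c).ne', sub_self])
  set p : D × Bool → ℝ := fun T => σ T.1 / L T.1 * ‖M.sideVector T 0‖ with hp
  have hpsum : ∀ d, p (d, false) + p (d, true) = σ d := by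
    intro d
    have := (hLpos d).ne'
    rw [hp, ← mul_add]
    change σ d / L d * L d = σ d
    field_simp
  have hprev : ∀ d s, p (M.rev d, s) = -p (d, !s) := by
    intro d s
    simp only [hp, hσ, hLrev, norm_sideVector_rev]
    ring
  -- `F d` is the flux out of `(d, false)` through the spoke to the start of `d`. `G d`, the flux
  -- out of `(d, true)` through the spoke to the edge point, is chosen to give `(d, false)` the
  -- right divergence; the recurrence for `F` then settles `(d, true)`.
  set G : D → ℝ := fun d => F d + p (d, false) - δ (M.cell d) * M.area (d, false) with hG
  set φ : D × Bool → Fin 3 → ℝ := fun T => bif T.2 then ![p T, -F (M.next T.1), G T.1]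
    else ![p T, -G T.1, F T.1] with hφ
  have hp0 : ∀ T, φ T 0 = p T := by
    rintro ⟨d, _ | _⟩ <;> simp [hφ]
  refine ⟨φ, ?_, ⟨fun e => σ (M.pos e) / L (M.pos e), fun e s => hp0 _⟩, ⟨δ, ?_⟩, fun d => ?_⟩
  · rintro ⟨d, _ | _⟩ <;> apply fin_three_cases <;> simp [hφ, glue, hprev]
  · rintro ⟨d, _ | _⟩
    · simp only [hφ, Fin.sum_univ_three, cond_false, Matrix.cons_val, hG]
      ring
    · simp only [hφ, Fin.sum_univ_three, cond_true, Matrix.cons_val, hG, hF]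
      linarith [hpsum d]
  · rw [outerFlux, hp0, hp0, hpsum]

theorem outerFlux_add (φ ψ : D × Bool → Fin 3 → ℝ) (d : D) :
    outerFlux (φ + ψ) d = outerFlux φ d + outerFlux ψ d := by
  simp only [outerFlux, Pi.add_apply]
  ring

theorem outerFlux_interiorVal (M : PolygonalMesh D V E C) (l : C → ℝ) (d : D) :
    outerFlux (M.curlFlux (interiorVal l)) d = 0 := by
  simp [outerFlux, curlFlux_interiorVal]

theorem exists_isVelocityBasis [Fintype D] [Fintype C] [DecidableEq E] (M : PolygonalMesh D V E C)
    (e : E) : ∃ u, M.IsVelocityBasis e u := by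
  classical
  set σ : D → ℝ := fun d => (if d = M.pos e then 1 else 0) - (if M.rev d = M.pos e then 1 else 0)
    with hσ
  obtain ⟨φ, hglue, ⟨κ, hκ⟩, ⟨δ, hδ⟩, hout⟩ := M.exists_flux (σ := σ) (by
    intro d
    simp only [hσ, M.rev_rev]
    ring)
  -- The correction has no divergence and no flux through primal edges, so the other conditions
  -- survive.
  obtain ⟨m, hm⟩ := M.exists_interior_correction φ
  refine ⟨_, IsHarmonicFlux.isVelocityBasis (φ := φ + M.curlFlux (interiorVal m))
    ⟨fun T a => ?_, ⟨κ, fun e s => ?_⟩, ⟨δ, fun T => ?_⟩, hm⟩ fun e' => ?_⟩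
  · simp only [Pi.add_apply]
    linarith [hglue T a, M.curlFlux_glue (interiorVal m) T a]
  · simp [Pi.add_apply, curlFlux_interiorVal, hκ]
  · simp only [Pi.add_apply, Finset.sum_add_distrib, sum_curlFlux, hδ, add_zero]
  · rw [outerFlux_add, outerFlux_interiorVal, hout, add_zero]
    have h1 : M.pos e' = M.pos e ↔ e' = e :=
      ⟨fun h => by rw [← M.edge_pos e', h, M.edge_pos], fun h => by rw [h]⟩
    have h2 : M.rev (M.pos e') ≠ M.pos e := by
      intro h
      have he : e' = e := by rw [← M.edge_pos e', ← M.edge_rev, h, M.edge_pos]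
      rw [he] at h
      exact M.rev_ne _ h
    simp only [hσ, h1, if_neg h2, sub_zero]

/-! ### The vertex basis functions -/

theorem norm_sideVector_false (M : PolygonalMesh D V E C) (d : D) :
    ‖M.sideVector (d, false) 0‖ = dist (M.xV (M.orig d)) (M.xE (M.edge d)) := by
  rw [dist_comm, dist_eq_norm]
  rfl

theorem norm_sideVector_true (M : PolygonalMesh D V E C) (d : D) :
    ‖M.sideVector (d, true) 0‖ = dist (M.xE (M.edge d)) (M.xV (M.orig (M.rev d))) := by
  rw [dist_comm, dist_eq_norm]
  rfl

/-- Constant slope along an edge turns into constant normal component of `∇^⊥ γ_j`, and its edge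
flux is the value at the start minus the value at the end, whence the sign. -/
theorem IsGamma.exists_harmonicFlux [Fintype D] [DecidableEq V] {M : PolygonalMesh D V E C} {j : V}
    {f : D × Bool → Space → ℝ} (hf : M.IsGamma j f) :
    ∃ val, M.IsP1 f val ∧ M.IsHarmonicFlux (M.curlFlux val) ∧
      ∀ e, outerFlux (M.curlFlux val) (M.pos e) = -M.D₁ e j := by
  obtain ⟨val, hP1, hval, hslope, horth⟩ := hf
  choose slope hs1 hs2 using hslope
  refine ⟨val, hP1, ⟨M.curlFlux_glue val, ⟨fun e => -slope (M.pos e), fun e s => ?_⟩,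
    ⟨0, fun T => ?_⟩, fun l => ?_⟩, fun e => ?_⟩
  · cases s
    · rw [norm_sideVector_false]
      simp only [curlFlux, node, zero_add, Matrix.cons_val]
      linarith [hs1 (M.pos e)]
    · rw [norm_sideVector_true]
      simp only [curlFlux, node, zero_add, Matrix.cons_val]
      linarith [hs2 (M.pos e)]
  · rw [sum_curlFlux, Pi.zero_apply, zero_mul]
  · have hg := M.isP1_p1Field (interiorVal l)
    rw [← hP1.inner_grad_grad hg]
    exact horth _ ((M.isInteriorP1_iff _).mpr ⟨l, hg⟩)
  · rw [D₁_apply, ← hval, ← hval]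
    simp only [outerFlux, curlFlux, node, zero_add, Matrix.cons_val]
    ring

theorem exists_isGamma [Fintype D] [Fintype C] [DecidableEq V] (M : PolygonalMesh D V E C) (j : V) :
    ∃ f, M.IsGamma j f := by
  set vV : V → ℝ := fun j' => if j' = j then 1 else 0 with hvV
  set l₀ : D → ℝ := fun d => dist (M.xV (M.orig d)) (M.xE (M.edge d)) with hl₀
  set l₁ : D → ℝ := fun d => dist (M.xE (M.edge d)) (M.xV (M.orig (M.rev d))) with hl₁
  have hpos : ∀ d, 0 < l₀ d + l₁ d := by
    intro d
    rw [hl₀, hl₁]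
    exact add_pos (by simpa only [norm_sideVector_false] using M.norm_sideVector_pos (d, false) 0)
      (by simpa only [norm_sideVector_true] using M.norm_sideVector_pos (d, true) 0)
  -- The edge point need not lie on the segment between the vertices, so the slope is taken over the
  -- length of the broken edge.
  set sl : D → ℝ := fun d => (vV (M.orig (M.rev d)) - vV (M.orig d)) / (l₀ d + l₁ d) with hsl
  set val₀ : V ⊕ (E ⊕ C) → ℝ := Sum.elim vV (Sum.elim
    (fun e => vV (M.orig (M.pos e)) + sl (M.pos e) * l₀ (M.pos e)) 0) with hval₀
  obtain ⟨m, hm⟩ := M.exists_interior_correction (M.curlFlux val₀)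
  have hP1 := M.isP1_p1Field (val₀ + interiorVal m)
  refine ⟨_, val₀ + interiorVal m, hP1, fun j' => ?_, fun d => ⟨sl d, ?_⟩, fun g hg => ?_⟩
  · simp [hval₀, interiorVal, hvV]
  · have hne := (hpos (M.pos (M.edge d))).ne'
    have key : sl (M.pos (M.edge d)) * (l₀ (M.pos (M.edge d)) + l₁ (M.pos (M.edge d))) =
        vV (M.orig (M.rev (M.pos (M.edge d)))) - vV (M.orig (M.pos (M.edge d))) :=
      div_mul_cancel₀ _ hne
    simp only [hval₀, interiorVal, Pi.add_apply, Sum.elim_inl, Sum.elim_inr, Pi.zero_apply,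
      add_zero]
    change _ = sl d * l₀ d ∧ _ = sl d * l₁ d
    rcases M.eq_pos_or_eq_rev_pos d with hd | hd
    · rw [← hd] at key ⊢
      constructor <;> linarith
    · have hr : M.rev d = M.pos (M.edge d) := by rw [hd, M.edge_rev, M.edge_pos, M.rev_rev]
      rw [← hr] at key ⊢
      rw [M.rev_rev] at key
      have h0 : l₀ (M.rev d) = l₁ d := by
        simp only [hl₀, hl₁, M.edge_rev]
        exact dist_comm _ _
      have h1 : l₁ (M.rev d) = l₀ d := by
        simp only [hl₀, hl₁, M.edge_rev, M.rev_rev]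
        exact dist_comm _ _
      have h2 : sl (M.rev d) = -sl d := by
        simp only [hsl, h0, h1, M.rev_rev]
        rw [← neg_div, neg_sub, add_comm]
      rw [h0, h1, h2] at key
      rw [h0, h2]
      constructor <;> linarith
  · obtain ⟨l, hl⟩ := (M.isInteriorP1_iff g).mp hg
    rw [hP1.inner_grad_grad hl, curlFlux_add, hm]

/-! ### The Coriolis matrix -/

/-- Rotation preserves the inner product as soon as one factor is tangential, so `u` is arbitrary.
-/
theorem IsP1.innerVector_perp_perp {M : PolygonalMesh D V E C} [Fintype D]
    {f : D × Bool → Space → ℝ} {val : V ⊕ (E ⊕ C) → ℝ} (hf : M.IsP1 f val)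
    (u : D × Bool → Space → Space) :
    M.innerVector (M.rtField (M.curlFlux val)) (M.perp u) = M.innerVector (M.grad f) u := by
  rw [← hf.perp_grad, innerVector, innerVector]
  congr 1
  funext T x
  obtain ⟨h, hx, hk, -⟩ := hf.grad_eq T
  rw [perp, perp, inner_cross_cross, inner_vert_vert, hx, real_inner_comm _ (M.vert T), hk]
  ring

theorem innerVector_perp_comm [Fintype D] (M : PolygonalMesh D V E C)
    (u w : D × Bool → Space → Space) :
    M.innerVector u (M.perp w) = -M.innerVector w (M.perp u) := by
  simp only [innerVector, integral, ← Finset.sum_neg_distrib]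
  refine Finset.sum_congr rfl fun T _ => ?_
  rw [← neg_one_mul, ← triIntegral_const_mul]
  congr 1
  funext x
  rw [neg_one_mul]
  exact inner_cross_comm _ _ _

theorem innerScalar_div_rtField [Fintype D] [Fintype E] [Fintype C] [DecidableEq C]
    (M : PolygonalMesh D V E C) {φ : D × Bool → Fin 3 → ℝ} (hφ : M.IsHarmonicFlux φ)
    (f : D × Bool → Space → ℝ) :
    M.innerScalar f (M.div (M.rtField φ)) =
      ∑ i, M.innerScalar f (M.alpha i) * ∑ e, M.D₂ i e * outerFlux φ (M.pos e) := by
  obtain ⟨δ, hδ⟩ := hφ.cell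
  -- Net outflow of a cell is its divergence times its area, so the divergence is a combination of
  -- the `α_i`.
  have hδ' : ∀ c, ∑ e, M.D₂ c e * outerFlux φ (M.pos e) = δ c * M.cellArea c := by
    intro c
    rw [M.sum_D₂_mul (outerFlux_rev hφ.glue), ← sum_cell_flux hφ.glue, cellArea, Finset.mul_sum]
    refine Finset.sum_congr rfl fun T _ => ?_
    split_ifs with hT
    · rw [hδ, hT]
    · rw [mul_zero]
  have hc : ∀ (i : C) (T : D × Bool), M.triIntegral T (fun x => f T x * M.alpha i T x) =
      (if M.cell T.1 = i then (M.cellArea i)⁻¹ else 0) * M.triIntegral T (f T) := by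
    intro i T
    simp only [alpha, mul_comm (f T _), triIntegral_const_mul]
  have hd : ∀ T : D × Bool, M.triIntegral T (fun x => f T x * M.div (M.rtField φ) T x) =
      δ (M.cell T.1) * M.triIntegral T (f T) := by
    intro T
    have ha := (M.area_pos T).ne'
    simp only [div_rtField, hδ, mul_comm (f T _), triIntegral_const_mul]
    field_simp
  simp only [innerScalar, integral, hc, hd, hδ', Finset.sum_mul]
  rw [Finset.sum_comm]
  refine Finset.sum_congr rfl fun T _ => ?_
  rw [Finset.sum_eq_single (M.cell T.1)]
  · have ha := (M.cellArea_pos (M.cell T.1)).ne'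
    rw [if_pos rfl]
    field_simp
  · intro i _ hi
    rw [if_neg hi.symm, zero_mul, zero_mul]
  · intro h
    exact absurd (Finset.mem_univ _) h

theorem continuous_perp_rtField (M : PolygonalMesh D V E C) (φ : D × Bool → Fin 3 → ℝ)
    (T : D × Bool) : Continuous (M.perp (M.rtField φ) T) :=
  (continuous_cross _).comp (M.continuous_rtField φ T)

theorem outerFlux_sum_smul {ι : Type*} [Fintype ι] (c : ι → ℝ) (φ : ι → D × Bool → Fin 3 → ℝ)
    (d : D) : outerFlux (∑ i, c i • φ i) d = ∑ i, c i * outerFlux (φ i) d := by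
  simp only [outerFlux, Finset.sum_apply, Pi.smul_apply, smul_eq_mul, mul_add,
    Finset.sum_add_distrib]

theorem neg_D₂bar_mul_W [Fintype D] [Fintype E] [Fintype C] [DecidableEq V] [DecidableEq E]
    [DecidableEq C] (M : PolygonalMesh D V E C) {γ : V → D × Bool → Space → ℝ}
    {v : E → D × Bool → Space → Space} (hγ : ∀ j, M.IsGamma j (γ j))
    (hv : ∀ e, M.IsVelocityBasis e (v e)) : -(M.D₂bar * M.W v) = M.R γ * M.D₂ := by
  choose φ hvφ hharm hout using fun e => (hv e).exists_harmonicFlux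
  ext j e'
  obtain ⟨val, hP1, hval, hvout⟩ := (hγ j).exists_harmonicFlux
  have hw := M.continuous_perp_rtField (φ e')
  -- This is `∑ t_{ej} v_e + ∇^⊥ γ_j`; its primal edge fluxes cancel, so it vanishes by uniqueness.
  have hsum : M.IsHarmonicFlux (∑ e, M.D₁ e j • φ e + M.curlFlux val) :=
    (IsHarmonicFlux.sum fun e _ => (hharm e).smul (M.D₁ e j)).add hval
  have hzero := hsum.rtField_eq_zero fun e => by
    rw [outerFlux_add, outerFlux_sum_smul, hvout]
    simp [hout]
  have h0 : M.innerVector (M.rtField (∑ e, M.D₁ e j • φ e + M.curlFlux val))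
      (M.perp (M.rtField (φ e'))) = 0 := by
    simp only [innerVector, integral, hzero, inner_zero_left, triIntegral_const, mul_zero,
      Finset.sum_const_zero]
  rw [M.innerVector_rtField_add _ _ hw, M.innerVector_rtField_sum _ _ hw,
    hP1.innerVector_perp_perp, hP1.innerVector_grad (hharm e').glue,
    innerScalar_div_rtField M (hharm e')] at h0
  simp only [innerVector_rtField_smul, hout, mul_ite, mul_one, mul_zero, Finset.sum_ite_eq',
    Finset.mem_univ, if_true] at h0
  simp only [Matrix.neg_apply, Matrix.mul_apply, D₂bar, Matrix.transpose_apply, W, R,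
    Matrix.of_apply, hvφ, mul_neg, Finset.sum_neg_distrib, neg_neg]
  linarith

end PolygonalMesh

end

theorem mainTheorem2 {D V E C : Type*} [Fintype D] [Fintype V] [Fintype E] [Fintype C]
    [DecidableEq V] [DecidableEq E] [DecidableEq C] (M : PolygonalMesh D V E C) :
    (∀ j : V, ∃ f : D × Bool → Space → ℝ, M.IsGamma j f) ∧
    (∀ e : E, ∃ u : D × Bool → Space → Space, M.IsVelocityBasis e u) ∧
    ∀ (γ : V → D × Bool → Space → ℝ) (v : E → D × Bool → Space → Space),
      (∀ j, M.IsGamma j (γ j)) → (∀ e, M.IsVelocityBasis e (v e)) →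
        (M.W v).transpose = -M.W v ∧
        -(M.D₂bar * M.W v) = M.R γ * M.D₂ ∧
        M.D₂bar * M.W v * M.D₁ = 0 := by
  refine ⟨M.exists_isGamma, M.exists_isVelocityBasis, fun γ v hγ hv => ?_⟩
  have h := M.neg_D₂bar_mul_W hγ hv
  refine ⟨?_, h, ?_⟩
  · ext e e'
    simp only [Matrix.transpose_apply, Matrix.neg_apply, PolygonalMesh.W, Matrix.of_apply]
    rw [M.innerVector_perp_comm]
  · rw [← neg_eq_zero, ← Matrix.neg_mul, h, Matrix.mul_assoc, M.D₂_mul_D₁, Matrix.mul_zero]
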